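/- Let $g:\mathbb R\to\mathbb R$ be nondecreasing and left-continuous, let $\mu_g$ be its Lebesgue–Stieltjes measure ($\mu_g([c,d))=g(d)-g(c)$), and let $\Delta g(t)=g(t^+)-g(t)$. Put $D_g=\{t:\Delta g(t)>0\}$ and $C_g=\{t: g \text{ is constant on } (t-\varepsilon,t+\varepsilon)\text{ for some }\varepsilon>0\}$. Let $C_g=\bigcup_n(a_n,b_n)$ be the decomposition into connected components, and let $N_g^-$ and $N_g^+$ be the sets of all finite $a_n$, respectively $b_n$, that are not in $D_g$. Let $T>0$ with $0\notin D_g\cup N_g^-$ and $T\notin N_g^+\cup D_g\cup C_g$. For $v:[0,T]\to\mathbb C$ and $t\in[0,T]$ let $t^*=t$ if $t\notin C_g$ and $t^*=b_n$ if $t\in(a_n,b_n)\subset C_g$. The $g$-derivative $v'_g(t)$ is the limit of $\frac{v(s)-v(t^*)}{g(s)-g(t^*)}$ as $s\to t^{*}$ from the right if $t\in D_g\cup C_g$, and as $s\to t$ within $\{s\in[0,T]: g(s)\ne g(t)\}$ otherwise. A function $v$ is $g$-continuous on $[0,T]$ if for all $t\in[0,T]$ and $\varepsilon>0$ there is $\delta>0$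 with $|v(t)-v(s)|<\varepsilon$ whenever $s\in[0,T]$ and $|g(t)-g(s)|<\delta$. $\mathcal{BC}_g([0,T];\mathbb C)$ is the set of bounded $g$-continuous functions, and $\mathcal{BC}^2_g([0,T];\mathbb C)$ is the set of $v$, twice $g$-differentiable everywhere on $[0,T]$, with $v,v'_g,v''_g\in\mathcal{BC}_g([0,T];\mathbb C)$. For $p\in L^1(\mu_g;[0,T))$ with $1+p\,\Delta g\neq0$ on $[0,T]\cap D_g$ put $\exp_g(p;t)=\exp\big(\int_{[0,t)}\tilde p\,d\mu_g\big)$, where $\tilde p=p$ off $D_g$ and $\tilde p=\ln(1+p\,\Delta g)/\Delta g$ on $D_g$ (principal logarithm). Let $f\in\mathcal{BC}_g([0,T];\mathbb C)$, $t_1\in[0,T]\cap D_g$, $w_1,w_2\in\mathbb R\setminus\{0\}$, $x_0,v_0\in\mathbb C$. Let $w_0=w_1$ on $[0,t_1]$, $w_0=w_2$ on $(t_1,T]$, and $\lambda_j^1=i\,w_j$, $\lambda_j^2=-i\,w_j$ ($j=1,2$). Consider $$v''_g(t)+w_0(t)^2v(t)=f(t),\quad t\in[0,T],\tag{1}$$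 $$v(0)=x_0,\qquad v'_g(0)=v_0,\tag{2}$$ where a solution is a function $v\in\mathcal{BC}_g^2([0,T];\mathbb C)$ satisfying the equations. For $k=1,2$ put $$\alpha_1^k=\frac{\exp_g(\lambda_1^k;t_1)(1+\lambda_1^k\Delta g(t_1))(\lambda_2^2-\lambda_1^k)}{\exp_g(\lambda_2^1;t_1)(1+\lambda_2^1\Delta g(t_1))(\lambda_2^2-\lambda_2^1)},\qquad \alpha_2^k=\frac{\exp_g(\lambda_1^k;t_1)(1+\lambda_1^k\Delta g(t_1))(\lambda_1^k-\lambda_2^1)}{\exp_g(\lambda_2^2;t_1)(1+\lambda_2^2\Delta g(t_1))(\lambda_2^2-\lambda_2^1)},$$ $$z_k=\alpha_1^k\exp_g(\lambda_2^1;\cdot)+\alpha_2^k\exp_g(\lambda_2^2;\cdot),\qquad y_k=\exp_g(\lambda_1^k;\cdot)\chi_{[0,t_1]}+z_k\,\chi_{(t_1,T]},$$ $$v_h=\frac{\lambda_1^2x_0-v_0}{\lambda_1^2-\lambda_1^1}\,y_1+\frac{v_0-\lambda_1^1x_0}{\lambda_1^2-\lambda_1^1}\,y_2,$$ and, with $E=\exp_g(w_0^2\,\Delta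 g;\cdot)$, $$v_{p_1}(t)=\frac{y_1(t)}{\lambda_1^2-\lambda_1^1}\int_{[0,t)}\frac{-(y_2+(y_2)'_g\Delta g)\,f}{(1+w_0^2(\Delta g)^2)\,E}\,d\mu_g+\frac{y_2(t)}{\lambda_1^2-\lambda_1^1}\int_{[0,t)}\frac{(y_1+(y_1)'_g\Delta g)\,f}{(1+w_0^2(\Delta g)^2)\,E}\,d\mu_g,$$ $$v_{p_2}(t)=\frac{z_1(t)}{\lambda_1^1-\lambda_1^2}\,\big[I_1+\alpha_1^2J_1(t)+\alpha_2^2J_2(t)\big]-\frac{z_2(t)}{\lambda_1^1-\lambda_1^2}\,\big[I_2+\alpha_1^1J_1(t)+\alpha_2^1J_2(t)\big],$$ where for $k=1,2$ $$I_k=\int_{[0,t_1)}\exp_g(\lambda_1^k;\cdot)^{-1}\frac{f}{1+\lambda_1^k\Delta g}\,d\mu_g+\exp_g(\lambda_1^k;t_1)^{-1}\frac{f(t_1)\,\Delta g(t_1)}{1+\lambda_1^k\Delta g(t_1)},$$ $$J_1(t)=\int_{(t_1,t)}\frac{\exp_g(\lambda_2^1;\cdot)}{(1+\lambda_2^2\Delta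 g)\,E}\,f\,d\mu_g,\qquad J_2(t)=\int_{(t_1,t)}\frac{\exp_g(\lambda_2^2;\cdot)}{(1+\lambda_2^1\Delta g)\,E}\,f\,d\mu_g .$$ Then all these $g$-exponentials and integrals are well defined; $y_1$ and $y_2$ are solutions of (1) with $f=0$; $v_h$ is the unique solution of (1)–(2) with $f=0$; $v_p=v_{p_1}\chi_{[0,t_1]}+v_{p_2}\chi_{(t_1,T]}$ is a solution of (1); and $v=v_p+v_h$ is the unique solution of (1)–(2). -/

import Mathlib

open Set Filter Topology MeasureTheory

noncomputable section

/-- A derivator: a nondecreasing, left-continuous function `ℝ → ℝ`. -/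
structure Derivator where
  toFun : ℝ → ℝ
  mono' : Monotone toFun
  leftCts' : ∀ t, ContinuousWithinAt toFun (Iic t) t

namespace Derivator

instance : CoeFun Derivator fun _ => ℝ → ℝ := ⟨toFun⟩

/-- The Lebesgue-Stieltjes measure `μ_g`; it is the Borel measure with
`μ_g [c, d) = g d - g c`, see `Derivator.measure_Ico`. -/
def measure (g : Derivator) : Measure ℝ := g.mono'.stieltjesFunction.measure

theorem leftLim_rightLim (g : Derivator) (x : ℝ) :
    Function.leftLim g.mono'.stieltjesFunction x = g x := by
  refine le_antisymm ?_ ?_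
  · have h1 : Tendsto g (𝓝[<] x) (𝓝 (g x)) :=
      (g.leftCts' x).mono_left (nhdsWithin_mono x Iio_subset_Iic_self)
    have h2 : Tendsto g.mono'.stieltjesFunction (𝓝[<] x)
        (𝓝 (Function.leftLim g.mono'.stieltjesFunction x)) :=
      g.mono'.stieltjesFunction.mono.tendsto_leftLim x
    refine le_of_tendsto h2 ?_
    filter_upwards [self_mem_nhdsWithin] with s hs
    exact g.mono'.rightLim_le hs
  · have h1 : Tendsto g (𝓝[<] x) (𝓝 (g x)) :=
      (g.leftCts' x).mono_left (nhdsWithin_mono x Iio_subset_Iic_self)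
    refine le_of_tendsto h1 ?_
    filter_upwards [self_mem_nhdsWithin] with s hs
    exact (g.mono'.le_rightLim le_rfl).trans
      (g.mono'.stieltjesFunction.mono.le_leftLim hs)

theorem measure_Ico (g : Derivator) (c d : ℝ) :
    g.measure (Ico c d) = ENNReal.ofReal (g d - g c) := by
  rw [measure, StieltjesFunction.measure_Ico, leftLim_rightLim, leftLim_rightLim]

/-- The jump `Δg(t) = g(t⁺) - g(t)`. -/
def jump (g : Derivator) (t : ℝ) : ℝ := Function.rightLim g t - g t

/-- The set `D_g` of discontinuity points of `g`. -/
def jumpSet (g : Derivator) : Set ℝ := {t | 0 < g.jump t}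

/-- The open set `C_g` of points around which `g` is constant. -/
def constSet (g : Derivator) : Set ℝ :=
  {t | ∃ ε > 0, ∀ s ∈ Ioo (t - ε) (t + ε), g s = g t}

/-- `N_g⁻`: the (finite) left end points of the connected components of `C_g`, without `D_g`. -/
def negSet (g : Derivator) : Set ℝ :=
  {a | a ∉ g.constSet ∧ ∃ b, a < b ∧ Ioo a b ⊆ g.constSet} \ g.jumpSet

/-- `N_g⁺`: the (finite) right end points of the connected components of `C_g`, without `D_g`. -/
def posSet (g : Derivator) : Set ℝ :=
  {b | b ∉ g.constSet ∧ ∃ a, a < b ∧ Ioo a b ⊆ g.constSet} \ g.jumpSet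

/-- The point `t*`: it is `t` if `t ∉ C_g`, and the right end point of the connected component of
`C_g` containing `t` if `t ∈ C_g` (and that component is bounded above). -/
def star (g : Derivator) (t : ℝ) : ℝ := sInf {s | t ≤ s ∧ s ∉ g.constSet}

open scoped Classical in
/-- The filter along which the difference quotient of a function on `[0, T]` is considered in the
`g`-derivative at `t`: `s → t*` from the right if `t ∈ D_g ∪ C_g`; otherwise `s → t` in the set
`{s ∈ [0, T] | g s ≠ g t}` on which the quotient is defined (this is a limit from the right for
`t ∈ N_g⁺ ∪ {0}` and from the left for `t ∈ N_g⁻ ∪ {T}`). -/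
def derivFilter (g : Derivator) (T t : ℝ) : Filter ℝ :=
  if t ∈ g.jumpSet ∪ g.constSet then 𝓝[Ioc (g.star t) T] (g.star t)
  else 𝓝[{s | s ∈ Icc 0 T ∧ g s ≠ g t}] t

/-- The difference quotient of `f` at `t*`. -/
def quot (g : Derivator) (f : ℝ → ℂ) (t s : ℝ) : ℂ :=
  (f s - f (g.star t)) / ((g s - g (g.star t) : ℝ) : ℂ)

/-- `f`, as a function on `[0, T]`, is `g`-differentiable at `t`. -/
def DiffAt (g : Derivator) (T : ℝ) (f : ℝ → ℂ) (t : ℝ) : Prop :=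
  ∃ L : ℂ, Tendsto (g.quot f t) (g.derivFilter T t) (𝓝 L)

/-- The `g`-derivative `f'_g` of `f`, as a function on `[0, T]`
(meaningful at the points of `[0, T]` where `f` is `g`-differentiable). -/
def deriv (g : Derivator) (T : ℝ) (f : ℝ → ℂ) (t : ℝ) : ℂ :=
  limUnder (g.derivFilter T t) (g.quot f t)

/-- `f` is `g`-continuous on `[0, T]`. -/
def ContOn (g : Derivator) (T : ℝ) (f : ℝ → ℂ) : Prop :=
  ∀ t ∈ Icc 0 T, ∀ ε > 0, ∃ δ > 0, ∀ s ∈ Icc 0 T, |g t - g s| < δ → ‖f t - f s‖ < ε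

/-- The restriction of `f` to `[0, T]` lies in `BC_g([0, T]; ℂ)`. -/
def MemBC (g : Derivator) (T : ℝ) (f : ℝ → ℂ) : Prop :=
  g.ContOn T f ∧ ∃ M : ℝ, ∀ t ∈ Icc 0 T, ‖f t‖ ≤ M

/-- The restriction of `f` to `[0, T]` lies in `BC_g^k([0, T]; ℂ)`: `f` is `k` times
`g`-differentiable everywhere on `[0, T]`, and `f` and its first `k` `g`-derivatives are bounded
and `g`-continuous. -/
def MemBCk (g : Derivator) (T : ℝ) : ℕ → (ℝ → ℂ) → Prop
  | 0, f => g.MemBC T f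
  | k + 1, f => g.MemBC T f ∧ (∀ t ∈ Icc 0 T, g.DiffAt T f t) ∧ MemBCk g T k (g.deriv T f)

/-- `p` is regressive and lies in `L¹_g([0, T); ℂ)`, so that it has a `g`-exponential. -/
def RegressiveIntegrable (g : Derivator) (T : ℝ) (p : ℝ → ℂ) : Prop :=
  (∀ t ∈ Icc 0 T ∩ g.jumpSet, 1 + p t * g.jump t ≠ 0) ∧ IntegrableOn p (Ico 0 T) g.measure

open scoped Classical in
/-- The integrand `p̃` in the definition of the `g`-exponential. -/
def expIntegrand (g : Derivator) (p : ℝ → ℂ) (s : ℝ) : ℂ :=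
  if s ∈ g.jumpSet then Complex.log (1 + p s * g.jump s) / g.jump s else p s

/-- The `g`-exponential `exp_g(p; t)`. -/
def gexp (g : Derivator) (p : ℝ → ℂ) (t : ℝ) : ℂ :=
  Complex.exp (∫ s in Ico 0 t, g.expIntegrand p s ∂g.measure)

/-- The `g`-exponential `exp_g(l; t)` of a constant `l`. -/
def cexp (g : Derivator) (l : ℂ) (t : ℝ) : ℂ := g.gexp (fun _ => l) t

end Derivator

namespace Helmholtz

open scoped Classical in
/-- The coefficient `w₀`: `w₁` on `[0, t₁]`, and `w₂` on `(t₁, T]`. -/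
def w0 (t₁ w₁ w₂ t : ℝ) : ℝ := if t ≤ t₁ then w₁ else w₂

/-- `v` is a solution of `v''_g + w₀² v = f` on `[0, T]`. -/
def IsSolution (g : Derivator) (T t₁ w₁ w₂ : ℝ) (f v : ℝ → ℂ) : Prop :=
  g.MemBCk T 2 v ∧
    ∀ t ∈ Icc 0 T, g.deriv T (g.deriv T v) t + (w0 t₁ w₁ w₂ t : ℂ) ^ 2 * v t = f t

/-- `v` is a solution of `v''_g + w₀² v = f` on `[0, T]`, `v(0) = x₀`, `v'_g(0) = v₀`. -/
def IsSolutionIVP (g : Derivator) (T t₁ w₁ w₂ : ℝ) (f : ℝ → ℂ) (x₀ v₀ : ℂ) (v : ℝ → ℂ) : Prop :=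
  IsSolution g T t₁ w₁ w₂ f v ∧ v 0 = x₀ ∧ g.deriv T v 0 = v₀

/-- `v` is the (unique) solution of the initial value problem on `[0, T]`. -/
def IsTheSolutionIVP (g : Derivator) (T t₁ w₁ w₂ : ℝ) (f : ℝ → ℂ) (x₀ v₀ : ℂ) (v : ℝ → ℂ) : Prop :=
  IsSolutionIVP g T t₁ w₁ w₂ f x₀ v₀ v ∧
    ∀ u, IsSolutionIVP g T t₁ w₁ w₂ f x₀ v₀ u → EqOn u v (Icc 0 T)

/-- For `w = w_j`: `lam w 0 = λ_j¹ = i w_j` and `lam w 1 = λ_j² = - i w_j`. (Upper indices `k = 1, 2`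
are written as `0, 1 : Fin 2` throughout.) -/
def lam (w : ℝ) (k : Fin 2) : ℂ := if k = 0 then Complex.I * w else -(Complex.I * w)

/-- The coefficient `α₁ᵏ`. -/
def alpha1 (g : Derivator) (t₁ w₁ w₂ : ℝ) (k : Fin 2) : ℂ :=
  (g.cexp (lam w₁ k) t₁ * (1 + lam w₁ k * g.jump t₁) * (lam w₂ 1 - lam w₁ k)) /
    (g.cexp (lam w₂ 0) t₁ * (1 + lam w₂ 0 * g.jump t₁) * (lam w₂ 1 - lam w₂ 0))

/-- The coefficient `α₂ᵏ`. -/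
def alpha2 (g : Derivator) (t₁ w₁ w₂ : ℝ) (k : Fin 2) : ℂ :=
  (g.cexp (lam w₁ k) t₁ * (1 + lam w₁ k * g.jump t₁) * (lam w₁ k - lam w₂ 0)) /
    (g.cexp (lam w₂ 1) t₁ * (1 + lam w₂ 1 * g.jump t₁) * (lam w₂ 1 - lam w₂ 0))

/-- The combination `α₁ᵏ exp_g(λ₂¹; t) + α₂ᵏ exp_g(λ₂²; t)`. -/
def yRight (g : Derivator) (t₁ w₁ w₂ : ℝ) (k : Fin 2) (t : ℝ) : ℂ :=
  alpha1 g t₁ w₁ w₂ k * g.cexp (lam w₂ 0) t + alpha2 g t₁ w₁ w₂ k * g.cexp (lam w₂ 1) t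

/-- The functions `y_k`, `k = 1, 2`. -/
def y (g : Derivator) (T t₁ w₁ w₂ : ℝ) (k : Fin 2) (t : ℝ) : ℂ :=
  (Icc 0 t₁).indicator (g.cexp (lam w₁ k)) t + (Ioc t₁ T).indicator (yRight g t₁ w₁ w₂ k) t

/-- The function `v_h`. -/
def vh (g : Derivator) (T t₁ w₁ w₂ : ℝ) (x₀ v₀ : ℂ) (t : ℝ) : ℂ :=
  (lam w₁ 1 * x₀ - v₀) / (lam w₁ 1 - lam w₁ 0) * y g T t₁ w₁ w₂ 0 t +
    (v₀ - lam w₁ 0 * x₀) / (lam w₁ 1 - lam w₁ 0) * y g T t₁ w₁ w₂ 1 t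

/-- The exponent `w₀² Δg`. -/
def expo (g : Derivator) (t₁ w₁ w₂ : ℝ) (s : ℝ) : ℂ := (w0 t₁ w₁ w₂ s : ℂ) ^ 2 * g.jump s

/-- The integrand `(y_k + (y_k)'_g Δg) f / ((1 + w₀² Δg²) exp_g(w₀² Δg; ·))`. -/
def integrandP (g : Derivator) (T t₁ w₁ w₂ : ℝ) (f : ℝ → ℂ) (k : Fin 2) (s : ℝ) : ℂ :=
  ((y g T t₁ w₁ w₂ k s + g.deriv T (y g T t₁ w₁ w₂ k) s * g.jump s) * f s) /
    ((1 + (w0 t₁ w₁ w₂ s : ℂ) ^ 2 * (g.jump s : ℂ) ^ 2) * g.gexp (expo g t₁ w₁ w₂) s)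

/-- The function `v_{p₁}`. -/
def vp1 (g : Derivator) (T t₁ w₁ w₂ : ℝ) (f : ℝ → ℂ) (t : ℝ) : ℂ :=
  y g T t₁ w₁ w₂ 0 t / (lam w₁ 1 - lam w₁ 0) *
      (∫ s in Ico 0 t, -integrandP g T t₁ w₁ w₂ f 1 s ∂g.measure) +
    y g T t₁ w₁ w₂ 1 t / (lam w₁ 1 - lam w₁ 0) *
      (∫ s in Ico 0 t, integrandP g T t₁ w₁ w₂ f 0 s ∂g.measure)

/-- The integrand `exp_g(l; ·)⁻¹ f / (1 + l Δg)`. -/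
def integrandL (g : Derivator) (f : ℝ → ℂ) (l : ℂ) (s : ℝ) : ℂ :=
  (g.cexp l s)⁻¹ * (f s / (1 + l * g.jump s))

/-- The integrand `exp_g(l; ·) / ((1 + m Δg) exp_g(w₀² Δg; ·)) f`. -/
def integrandR (g : Derivator) (t₁ w₁ w₂ : ℝ) (f : ℝ → ℂ) (l m : ℂ) (s : ℝ) : ℂ :=
  g.cexp l s / ((1 + m * g.jump s) * g.gexp (expo g t₁ w₁ w₂) s) * f s

/-- The function `v_{p₂}`. -/
def vp2 (g : Derivator) (t₁ w₁ w₂ : ℝ) (f : ℝ → ℂ) (t : ℝ) : ℂ :=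
  yRight g t₁ w₁ w₂ 0 t / (lam w₁ 0 - lam w₁ 1) *
      ((∫ s in Ico 0 t₁, integrandL g f (lam w₁ 0) s ∂g.measure) +
        (g.cexp (lam w₁ 0) t₁)⁻¹ * (f t₁ * g.jump t₁ / (1 + lam w₁ 0 * g.jump t₁)) +
        alpha1 g t₁ w₁ w₂ 1 *
          (∫ s in Ioo t₁ t, integrandR g t₁ w₁ w₂ f (lam w₂ 0) (lam w₂ 1) s ∂g.measure) +
        alpha2 g t₁ w₁ w₂ 1 *
          (∫ s in Ioo t₁ t, integrandR g t₁ w₁ w₂ f (lam w₂ 1) (lam w₂ 0) s ∂g.measure)) -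
    yRight g t₁ w₁ w₂ 1 t / (lam w₁ 0 - lam w₁ 1) *
      ((∫ s in Ico 0 t₁, integrandL g f (lam w₁ 1) s ∂g.measure) +
        (g.cexp (lam w₁ 1) t₁)⁻¹ * (f t₁ * g.jump t₁ / (1 + lam w₁ 1 * g.jump t₁)) +
        alpha1 g t₁ w₁ w₂ 0 *
          (∫ s in Ioo t₁ t, integrandR g t₁ w₁ w₂ f (lam w₂ 0) (lam w₂ 1) s ∂g.measure) +
        alpha2 g t₁ w₁ w₂ 0 *
          (∫ s in Ioo t₁ t, integrandR g t₁ w₁ w₂ f (lam w₂ 1) (lam w₂ 0) s ∂g.measure))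

/-- The function `v_p = v_{p₁} χ_{[0, t₁]} + v_{p₂} χ_{(t₁, T]}`. -/
def vp (g : Derivator) (T t₁ w₁ w₂ : ℝ) (f : ℝ → ℂ) (t : ℝ) : ℂ :=
  (Icc 0 t₁).indicator (vp1 g T t₁ w₁ w₂ f) t + (Ioc t₁ T).indicator (vp2 g t₁ w₁ w₂ f) t

/-- All the `g`-exponentials and all the integrals in the formulas are well defined. -/
def FormulasWellDefined (g : Derivator) (T t₁ w₁ w₂ : ℝ) (f : ℝ → ℂ) : Prop :=
  (∀ k, g.RegressiveIntegrable T (fun _ => lam w₁ k) ∧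
    IntegrableOn (g.expIntegrand fun _ => lam w₁ k) (Ico 0 T) g.measure) ∧
  (∀ k, g.RegressiveIntegrable T (fun _ => lam w₂ k) ∧
    IntegrableOn (g.expIntegrand fun _ => lam w₂ k) (Ico 0 T) g.measure) ∧
  (g.RegressiveIntegrable T (expo g t₁ w₁ w₂) ∧
    IntegrableOn (g.expIntegrand (expo g t₁ w₁ w₂)) (Ico 0 T) g.measure) ∧
  (∀ k, IntegrableOn (integrandP g T t₁ w₁ w₂ f k) (Ico 0 T) g.measure) ∧
  (∀ k, IntegrableOn (integrandL g f (lam w₁ k)) (Ico 0 t₁) g.measure) ∧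
  IntegrableOn (integrandR g t₁ w₁ w₂ f (lam w₂ 0) (lam w₂ 1)) (Ioo t₁ T) g.measure ∧
  IntegrableOn (integrandR g t₁ w₁ w₂ f (lam w₂ 1) (lam w₂ 0)) (Ioo t₁ T) g.measure

end Helmholtz

end

/-! A `g`-continuous function factors through `g`, so values at `t` and `t*` agree, and the
hypotheses at `0` and `T` make the filter of the `g`-derivative proper at every point of `[0, T]`.
If `F` has `g`-derivative `L` at `t`, then `F` tends along that filter to `F(t*) + L Δg(t*)`
(`HasGDeriv.tendsto`). All jump corrections come from this expression: the extra term in the product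
rule, the factor `1 + p Δg` in the exponential, and the matching condition at `t₁`
(`HasGDeriv.glue`).

The coefficients `α` are chosen so that both `y_k` and its derivative satisfy this matching
condition at `t₁`; hence `y_k` solves the homogeneous equation. Since `(1 + i w Δg)(1 - i w Δg) = 1
+ w² Δg²` and the principal logarithms of the two factors add up, the Wronskian of `y₁, y₂` is `(λ₁²
- λ₁¹) E` (`wronskian`).

Both `v_{p₁}` and `v_{p₂}` are one variation of parameters formula, `varParam`, with its integrals
cut at `t₁` for the second (`vp_eqOn`). Its two derivatives follow from the product rule and a
fundamental theorem of calculus valid at every point (`Admissible.hasGDeriv_integral`); the factor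
`(1 + w₀² Δg²) E` in the integrands is what the Wronskian produces after the jump corrections.

Uniqueness is a Grönwall argument: a homogeneous first-order system with zero data stays below `ε
exp(c g)` for every `ε > 0` (`eq_zero_of_hasGDeriv`). -/

/-- Induction along an interval, from left to right. -/
theorem Real.interval_induction {a b : ℝ} {P : ℝ → Prop} (ha : P a)
    (hleft : ∀ s ∈ Ioc a b, (∀ r ∈ Ico a s, P r) → P s)
    (hright : ∀ s ∈ Ico a b, P s → ∀ᶠ r in 𝓝[>] s, r ≤ b → P r) :
    ∀ s ∈ Icc a b, P s := by
  by_contra! hcon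
  obtain ⟨s₀, hs₀, hns₀⟩ := hcon
  set S : Set ℝ := {s | s ∈ Icc a b ∧ ¬ P s} with hS
  have hne : S.Nonempty := ⟨s₀, hs₀, hns₀⟩
  have hbd : BddBelow S := ⟨a, fun s hs => hs.1.1⟩
  set τ := sInf S with hτ
  have haτ : a ≤ τ := le_csInf hne fun s hs => hs.1.1
  have hτb : τ ≤ s₀ := csInf_le hbd ⟨hs₀, hns₀⟩
  have hlt : ∀ r ∈ Ico a τ, P r := by
    intro r hr
    by_contra hPr
    exact absurd (csInf_le hbd (show r ∈ S from ⟨⟨hr.1, (hr.2.le.trans hτb).trans hs₀.2⟩, hPr⟩))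
      (not_le.2 hr.2)
  have hPτ : P τ := by
    rcases haτ.eq_or_lt with h | h
    · rwa [← h]
    · exact hleft τ ⟨h, hτb.trans hs₀.2⟩ hlt
  -- The infimum `τ` of the counterexamples is not one itself, so they accumulate at `τ` from the
  -- right, against `hright`.
  have hτs : τ < s₀ := lt_of_le_of_ne hτb fun h => hns₀ (h ▸ hPτ)
  have hev := hright τ ⟨haτ, hτs.trans_le hs₀.2⟩ hPτ
  obtain ⟨u, hu, hsub⟩ := mem_nhdsGT_iff_exists_Ioo_subset.1 hev
  obtain ⟨s, hsS, hsu⟩ := exists_lt_of_csInf_lt hne (show sInf S < u from hu)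
  have hτs' : τ ≤ s := csInf_le hbd hsS
  rcases hτs'.eq_or_lt with h | h
  · exact hsS.2 (h ▸ hPτ)
  · exact hsS.2 (hsub ⟨h, hsu⟩ hsS.1.2)

/-! ### Jumps, flat pieces, the point `t*` and the filter of the `g`-derivative -/

namespace Derivator

variable {g : Derivator} {T t t₁ : ℝ} {F G : ℝ → ℂ}

theorem jump_nonneg (g : Derivator) (t : ℝ) : 0 ≤ g.jump t :=
  sub_nonneg.2 (g.mono'.le_rightLim le_rfl)

theorem jump_eq_zero (h : t ∉ g.jumpSet) : g.jump t = 0 :=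
  le_antisymm (not_lt.1 h) (g.jump_nonneg t)

theorem add_jump_le (g : Derivator) {s t : ℝ} (h : s < t) : g s + g.jump s ≤ g t := by
  have := g.mono'.rightLim_le h
  simp only [jump]; linarith

theorem tendsto_nhdsGT (g : Derivator) (t : ℝ) :
    Tendsto g (𝓝[>] t) (𝓝 (g t + g.jump t)) := by
  have := g.mono'.tendsto_rightLim t
  simpa [jump] using this

theorem continuousAt_of_notMem (h : t ∉ g.jumpSet) : ContinuousAt g t := by
  refine continuousAt_iff_continuous_left_right.2 ⟨g.leftCts' t, ?_⟩
  refine continuousWithinAt_Ioi_iff_Ici.1 ?_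
  have := g.tendsto_nhdsGT t
  rwa [jump_eq_zero h, add_zero] at this

theorem isOpen_constSet (g : Derivator) : IsOpen g.constSet := by
  refine Metric.isOpen_iff.2 fun t ht => ?_
  obtain ⟨ε, hε, h⟩ := ht
  refine ⟨ε, hε, fun s hs => ?_⟩
  rw [Real.ball_eq_Ioo] at hs
  refine ⟨min (s - (t - ε)) (t + ε - s), lt_min (by linarith [hs.1]) (by linarith [hs.2]), ?_⟩
  intro r hr
  have h1 := min_le_left (s - (t - ε)) (t + ε - s)
  have h2 := min_le_right (s - (t - ε)) (t + ε - s)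
  rw [h r ⟨by linarith [hr.1], by linarith [hr.2]⟩, h s hs]

theorem mem_constSet_of_eq {a b : ℝ} (h : g a = g b) (ht : t ∈ Ioo a b) : t ∈ g.constSet := by
  have key : ∀ s ∈ Ioo a b, g s = g a := fun s hs =>
    le_antisymm (h ▸ g.mono' hs.2.le) (g.mono' hs.1.le)
  refine ⟨min (t - a) (b - t), lt_min (by linarith [ht.1]) (by linarith [ht.2]), fun s hs => ?_⟩
  have h1 := min_le_left (t - a) (b - t)
  have h2 := min_le_right (t - a) (b - t)
  rw [key t ht, key s ⟨by linarith [hs.1], by linarith [hs.2]⟩]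

theorem eventually_eq_of_mem_constSet (h : t ∈ g.constSet) : ∀ᶠ s in 𝓝 t, g s = g t := by
  obtain ⟨ε, hε, h⟩ := h
  filter_upwards [Ioo_mem_nhds (show t - ε < t by linarith) (show t < t + ε by linarith)] with s hs
  exact h s hs

theorem jump_eq_zero_of_mem_constSet (h : t ∈ g.constSet) : g.jump t = 0 := by
  have h1 : Tendsto g (𝓝[>] t) (𝓝 (g t)) :=
    tendsto_const_nhds.congr' <| by
      filter_upwards [(eventually_eq_of_mem_constSet h).filter_mono nhdsWithin_le_nhds] with s hs
      exact hs.symm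
  have := tendsto_nhds_unique h1 (g.tendsto_nhdsGT t)
  linarith

theorem notMem_constSet (h : t ∈ g.jumpSet) : t ∉ g.constSet := fun hc =>
  (ne_of_gt h) (jump_eq_zero_of_mem_constSet hc)

/-- Local constancy propagates to the right, and left-continuity carries the value to `b`, which
need not lie in `C_g`. This yields `g(t*) = g(t)`. -/
theorem eq_of_Ico_subset_constSet {a b : ℝ} (hab : a ≤ b) (h : Ico a b ⊆ g.constSet) :
    g b = g a := by
  refine Real.interval_induction (a := a) (b := b) (P := fun s => g s = g a) rfl ?_ ?_ b
    ⟨hab, le_rfl⟩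
  · intro s hs hr
    have h1 : Tendsto g (𝓝[<] s) (𝓝 (g s)) :=
      (g.leftCts' s).mono_left (nhdsWithin_mono _ Iio_subset_Iic_self)
    have h2 : Tendsto g (𝓝[<] s) (𝓝 (g a)) := tendsto_const_nhds.congr' <| by
      filter_upwards [Ico_mem_nhdsLT hs.1] with r hr'
      exact (hr r hr').symm
    exact tendsto_nhds_unique h1 h2
  · intro s hs hgs
    filter_upwards [(eventually_eq_of_mem_constSet (h hs)).filter_mono nhdsWithin_le_nhds]
      with r hr _
    rw [hr, hgs]

/-- The standing assumptions on the interval `[0, T]`. -/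
structure GoodInterval (g : Derivator) (T : ℝ) : Prop where
  pos : 0 < T
  left : (0 : ℝ) ∉ g.jumpSet ∪ g.negSet
  right : T ∉ g.posSet ∪ g.jumpSet ∪ g.constSet

namespace GoodInterval

/-- Equality would make `g` flat on `(s, T)`, and `T` would then fall into one of the excluded sets.
-/
theorem lt_right (H : g.GoodInterval T) {s : ℝ} (hs : s < T) : g s < g T := by
  refine lt_of_le_of_ne (g.mono' hs.le) fun h => H.right (Or.inl (Or.inl ⟨⟨?_, s, hs, ?_⟩, ?_⟩))
  · exact fun hc => H.right (Or.inr hc)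
  · exact fun r hr => mem_constSet_of_eq h hr
  · exact fun hj => H.right (Or.inl (Or.inr hj))

theorem left_lt (H : g.GoodInterval T) (h0 : (0 : ℝ) ∉ g.constSet) {s : ℝ} (hs : 0 < s) :
    g 0 < g s := by
  refine lt_of_le_of_ne (g.mono' hs.le) fun h => H.left (Or.inr ⟨⟨h0, s, hs, ?_⟩, ?_⟩)
  · exact fun r hr => mem_constSet_of_eq h hr
  · exact fun hj => H.left (Or.inl hj)

/-- The complement of `C_g` is closed and contains `T`, so the infimum defining `t*` is attained and
does not exceed `T`. -/
theorem star_spec (H : g.GoodInterval T) (ht : t ∈ Icc 0 T) :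
    t ≤ g.star t ∧ g.star t ≤ T ∧ g.star t ∉ g.constSet ∧ ∀ s ∉ g.constSet, t ≤ s → g.star t ≤ s := by
  have hbd : BddBelow {s | t ≤ s ∧ s ∉ g.constSet} := ⟨t, fun s hs => hs.1⟩
  have hT : T ∈ {s | t ≤ s ∧ s ∉ g.constSet} := ⟨ht.2, fun h => H.right (Or.inr h)⟩
  have hcl : IsClosed {s | t ≤ s ∧ s ∉ g.constSet} :=
    isClosed_Ici.inter g.isOpen_constSet.isClosed_compl
  have hm := hcl.csInf_mem ⟨T, hT⟩ hbd
  exact ⟨hm.1, csInf_le hbd hT, hm.2, fun s hs hts => csInf_le hbd ⟨hts, hs⟩⟩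

theorem star_mem (H : g.GoodInterval T) (ht : t ∈ Icc 0 T) : g.star t ∈ Icc 0 T :=
  ⟨ht.1.trans (H.star_spec ht).1, (H.star_spec ht).2.1⟩

theorem star_eq (H : g.GoodInterval T) (ht : t ∈ Icc 0 T) (h : t ∉ g.constSet) : g.star t = t :=
  le_antisymm ((H.star_spec ht).2.2.2 t h le_rfl) (H.star_spec ht).1

theorem apply_star (H : g.GoodInterval T) (ht : t ∈ Icc 0 T) : g (g.star t) = g t := by
  refine eq_of_Ico_subset_constSet (H.star_spec ht).1 fun s hs => ?_
  by_contra hc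
  exact absurd ((H.star_spec ht).2.2.2 s hc hs.1) (not_le.2 hs.2)

theorem star_lt (H : g.GoodInterval T) (ht : t ∈ Icc 0 T) (h : t ∈ g.jumpSet ∪ g.constSet) :
    g.star t < T := by
  refine lt_of_le_of_ne (H.star_spec ht).2.1 fun hs => ?_
  have htT : t < T := lt_of_le_of_ne ht.2 fun h' => by
    subst h'
    rcases h with h | h
    exacts [H.right (Or.inl (Or.inr h)), H.right (Or.inr h)]
  have := H.lt_right htT
  rw [← H.apply_star ht, hs] at this
  exact lt_irrefl _ this

/-- A component of `C_g` cannot contain the jump point `t₁`, so `t` and `t*` lie on the same side of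
it. -/
theorem star_le_iff (H : g.GoodInterval T) (ht : t ∈ Icc 0 T) (ht₁ : t₁ ∈ g.jumpSet) :
    g.star t ≤ t₁ ↔ t ≤ t₁ :=
  ⟨fun h => (H.star_spec ht).1.trans h, fun h => (H.star_spec ht).2.2.2 t₁ (notMem_constSet ht₁) h⟩

theorem mem_Ioo (H : g.GoodInterval T) (ht : t ∈ Icc 0 T) (hj : t ∈ g.jumpSet) : t ∈ Ioo 0 T := by
  refine ⟨lt_of_le_of_ne ht.1 ?_, lt_of_le_of_ne ht.2 ?_⟩ <;> rintro rfl
  exacts [H.left (Or.inl hj), H.right (Or.inl (Or.inr hj))]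

theorem derivFilter_le (H : g.GoodInterval T) (ht : t ∈ Icc 0 T) :
    g.derivFilter T t ≤ 𝓝 (g.star t) := by
  unfold derivFilter
  split_ifs with h
  · exact nhdsWithin_le_nhds
  · rw [H.star_eq ht fun hc => h (Or.inr hc)]
    exact nhdsWithin_le_nhds

theorem derivFilter_le_nhdsGT (H : g.GoodInterval T) (ht : t ∈ Icc 0 T)
    (hj : g.star t ∈ g.jumpSet) : g.derivFilter T t ≤ 𝓝[>] (g.star t) := by
  unfold derivFilter
  split_ifs with h
  · exact nhdsWithin_mono _ Ioc_subset_Ioi_self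
  · rw [H.star_eq ht fun hc => h (Or.inr hc)] at hj
    exact absurd (Or.inl hj) h

theorem eventually_derivFilter (H : g.GoodInterval T) (ht : t ∈ Icc 0 T) :
    ∀ᶠ s in g.derivFilter T t, s ∈ Icc 0 T ∧ g s ≠ g (g.star t) := by
  unfold derivFilter
  split_ifs with h
  · filter_upwards [self_mem_nhdsWithin] with s hs
    refine ⟨⟨(H.star_mem ht).1.trans hs.1.le, hs.2⟩, fun he => ?_⟩
    by_cases hj : g.star t ∈ g.jumpSet
    · have := g.add_jump_le hs.1
      have : 0 < g.jump (g.star t) := hj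
      linarith
    · have hc : t ∈ g.constSet := by
        rcases h with h | h
        · rw [H.star_eq ht (notMem_constSet h)] at hj
          exact absurd h hj
        · exact h
      have hlt : t < g.star t := lt_of_le_of_ne (H.star_spec ht).1 fun h' =>
        (H.star_spec ht).2.2.1 (h' ▸ hc)
      exact (H.star_spec ht).2.2.1
        (mem_constSet_of_eq ((H.apply_star ht).symm.trans he.symm) ⟨hlt, hs.1⟩)
  · rw [H.star_eq ht fun hc => h (Or.inr hc)]
    exact self_mem_nhdsWithin

/-- Properness gives uniqueness of the `g`-derivative. Off `D_g ∪ C_g`, points with `g s ≠ g t`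
exist arbitrarily near `t`; at `0` and `T` the endpoint hypotheses provide them inside `[0, T]`. -/
theorem derivFilter_neBot (H : g.GoodInterval T) (ht : t ∈ Icc 0 T) :
    (g.derivFilter T t).NeBot := by
  unfold derivFilter
  split_ifs with h
  · rw [nhdsWithin_Ioc_eq_nhdsGT (H.star_lt ht h)]
    infer_instance
  · have hc : t ∉ g.constSet := fun hc => h (Or.inr hc)
    refine mem_closure_iff_nhdsWithin_neBot.1 (Metric.mem_closure_iff.2 fun ε hε => ?_)
    rcases ht.1.eq_or_lt with h0 | h0
    · subst h0
      have hm : 0 < min (ε / 2) T := lt_min (by linarith) H.pos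
      refine ⟨min (ε / 2) T, ⟨⟨hm.le, min_le_right _ _⟩, (H.left_lt hc hm).ne'⟩, ?_⟩
      rw [dist_comm, Real.dist_eq, sub_zero, abs_of_pos hm]
      linarith [min_le_left (ε / 2) T]
    rcases ht.2.eq_or_lt with hT | hT
    · subst hT
      have hm : 0 < min (ε / 2) t := lt_min (by linarith) H.pos
      refine ⟨t - min (ε / 2) t, ⟨⟨by linarith [min_le_right (ε / 2) t], by linarith⟩,
        (H.lt_right (by linarith)).ne⟩, ?_⟩
      rw [Real.dist_eq, sub_sub_cancel, abs_of_pos hm]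
      linarith [min_le_left (ε / 2) t]
    · have hm : 0 < min ε (min t (T - t)) := lt_min hε (lt_min h0 (by linarith))
      have h1 := min_le_left ε (min t (T - t))
      have h2 := min_le_right ε (min t (T - t))
      have h3 := min_le_left t (T - t)
      have h4 := min_le_right t (T - t)
      have hn : ¬ ∃ ε > 0, ∀ s ∈ Ioo (t - ε) (t + ε), g s = g t := hc
      push Not at hn
      obtain ⟨s, hs, hne⟩ := hn _ hm
      refine ⟨s, ⟨⟨by linarith [hs.1], by linarith [hs.2]⟩, hne⟩, ?_⟩
      rw [Real.dist_eq, abs_lt]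
      constructor <;> linarith [hs.1, hs.2]

/-- This limit allows jump points and continuity points to be treated together in the
differentiation rules. -/
theorem tendsto_sub (H : g.GoodInterval T) (ht : t ∈ Icc 0 T) :
    Tendsto (fun s => g s - g (g.star t)) (g.derivFilter T t) (𝓝 (g.jump (g.star t))) := by
  by_cases hj : g.star t ∈ g.jumpSet
  · have := ((g.tendsto_nhdsGT (g.star t)).mono_left (H.derivFilter_le_nhdsGT ht hj)).sub_const
      (g (g.star t))
    simpa using this
  · have := (((continuousAt_of_notMem hj).tendsto).mono_left (H.derivFilter_le ht)).sub_const
      (g (g.star t))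
    simpa [jump_eq_zero hj] using this

theorem eventually_eq_add_quot_mul (H : g.GoodInterval T) (ht : t ∈ Icc 0 T) (F : ℝ → ℂ) :
    ∀ᶠ s in g.derivFilter T t,
      F s = F (g.star t) + g.quot F t s * ((g s - g (g.star t) : ℝ) : ℂ) := by
  filter_upwards [H.eventually_derivFilter ht] with s hs
  have : ((g s - g (g.star t) : ℝ) : ℂ) ≠ 0 := Complex.ofReal_ne_zero.2 (sub_ne_zero.2 hs.2)
  rw [quot, div_mul_cancel₀ _ this]; ring

end GoodInterval

/-! ### `g`-continuous functions -/

theorem ContOn.congr (hF : g.ContOn T F) (h : EqOn F G (Icc 0 T)) : g.ContOn T G := by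
  intro t ht ε hε
  obtain ⟨δ, hδ, hd⟩ := hF t ht ε hε
  exact ⟨δ, hδ, fun s hs hst => by rw [← h ht, ← h hs]; exact hd s hs hst⟩

/-- `g`-continuity is continuity for the topology pulled back along `g`, so the usual limit rules
apply. -/
theorem contOn_iff_tendsto : g.ContOn T F ↔
    ∀ t ∈ Icc 0 T, Tendsto F (comap g (𝓝 (g t)) ⊓ 𝓟 (Icc 0 T)) (𝓝 (F t)) := by
  refine forall₂_congr fun t ht => ?_
  have hb : (comap g (𝓝 (g t)) ⊓ 𝓟 (Icc 0 T)).HasBasis (fun δ : ℝ => 0 < δ)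
      fun δ => g ⁻¹' Metric.ball (g t) δ ∩ Icc 0 T := by
    exact (Metric.nhds_basis_ball.comap g).inf_principal _
  rw [hb.tendsto_iff Metric.nhds_basis_ball]
  refine forall₂_congr fun ε hε => exists_congr fun δ => and_congr_right fun hδ => ?_
  constructor
  · intro h s hs
    rw [Metric.mem_ball, dist_comm, dist_eq_norm]
    refine h s hs.2 ?_
    have := hs.1
    rwa [mem_preimage, Metric.mem_ball, dist_comm, Real.dist_eq] at this
  · intro h s hs hst
    have := h s ⟨by rwa [mem_preimage, Metric.mem_ball, dist_comm, Real.dist_eq], hs⟩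
    rwa [Metric.mem_ball, dist_comm, dist_eq_norm] at this

theorem ContOn.continuousWithinAt (hF : g.ContOn T F) (ht : t ∈ Icc 0 T) {S : Set ℝ}
    (hS : S ⊆ Icc 0 T) (hg : ContinuousWithinAt g S t) : ContinuousWithinAt F S t := by
  refine (contOn_iff_tendsto.1 hF t ht).mono_left (le_inf hg.tendsto.le_comap ?_)
  exact (inf_le_right).trans (principal_mono.2 hS)

theorem ContOn.eq_of_eq (hF : g.ContOn T F) {s : ℝ} (ht : t ∈ Icc 0 T) (hs : s ∈ Icc 0 T)
    (h : g t = g s) : F t = F s := by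
  refine eq_of_forall_dist_le fun ε hε => ?_
  obtain ⟨δ, hδ, hd⟩ := hF t ht ε hε
  rw [dist_eq_norm]
  exact (hd s hs (by simpa [h] using hδ)).le

theorem MemBC.congr (hF : g.MemBC T F) (h : EqOn F G (Icc 0 T)) : g.MemBC T G := by
  obtain ⟨hc, M, hM⟩ := hF
  exact ⟨hc.congr h, M, fun t ht => h ht ▸ hM t ht⟩

theorem MemBC.apply_star (hF : g.MemBC T F) (H : g.GoodInterval T) (ht : t ∈ Icc 0 T) :
    F (g.star t) = F t :=
  hF.1.eq_of_eq (H.star_mem ht) ht (H.apply_star ht)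

theorem memBC_const (c : ℂ) : g.MemBC T fun _ => c :=
  ⟨fun _ _ ε hε => ⟨1, one_pos, fun _ _ _ => by simpa using hε⟩, ‖c‖, fun _ _ => le_rfl⟩

theorem MemBC.add (hF : g.MemBC T F) (hG : g.MemBC T G) : g.MemBC T fun t => F t + G t := by
  obtain ⟨hF, M, hM⟩ := hF
  obtain ⟨hG, N, hN⟩ := hG
  refine ⟨contOn_iff_tendsto.2 fun t ht => ?_, M + N, fun t ht => ?_⟩
  · exact (contOn_iff_tendsto.1 hF t ht).add (contOn_iff_tendsto.1 hG t ht)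
  · exact (norm_add_le _ _).trans (add_le_add (hM t ht) (hN t ht))

theorem MemBC.mul (hF : g.MemBC T F) (hG : g.MemBC T G) : g.MemBC T fun t => F t * G t := by
  obtain ⟨hF, M, hM⟩ := hF
  obtain ⟨hG, N, hN⟩ := hG
  refine ⟨contOn_iff_tendsto.2 fun t ht => ?_, M * N, fun t ht => ?_⟩
  · exact (contOn_iff_tendsto.1 hF t ht).mul (contOn_iff_tendsto.1 hG t ht)
  · rw [norm_mul]
    exact mul_le_mul (hM t ht) (hN t ht) (norm_nonneg _) ((norm_nonneg _).trans (hM t ht))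

theorem MemBC.const_mul (hF : g.MemBC T F) (c : ℂ) : g.MemBC T fun t => c * F t :=
  (memBC_const c).mul hF

theorem MemBC.cexp (hF : g.MemBC T F) : g.MemBC T fun t => Complex.exp (F t) := by
  obtain ⟨hF, M, hM⟩ := hF
  refine ⟨contOn_iff_tendsto.2 fun t ht => ?_, Real.exp M, fun t ht => ?_⟩
  · exact (Complex.continuous_exp.tendsto _).comp (contOn_iff_tendsto.1 hF t ht)
  · rw [Complex.norm_exp]
    exact Real.exp_le_exp.2 ((Complex.re_le_norm _).trans (hM t ht))

/-- The function equal to `F` on `(-∞, t₁]` and to `G` on `(t₁, ∞)`. -/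
noncomputable def glue (t₁ : ℝ) (F G : ℝ → ℂ) (t : ℝ) : ℂ := if t ≤ t₁ then F t else G t

theorem glue_of_le (h : t ≤ t₁) : glue t₁ F G t = F t := if_pos h

theorem glue_of_lt (h : t₁ < t) : glue t₁ F G t = G t := if_neg (not_le.2 h)

/-- The values of `g` on the two sides of `t₁` are at least `Δg(t₁)` apart, so a `δ` of at most that
size never compares `F` with `G`. No matching at `t₁` is needed. -/
theorem MemBC.glue (ht₁ : t₁ ∈ g.jumpSet) (hF : g.MemBC T F) (hG : g.MemBC T G) :
    g.MemBC T (glue t₁ F G) := by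
  obtain ⟨hF, M, hM⟩ := hF
  obtain ⟨hG, N, hN⟩ := hG
  have hj : 0 < g.jump t₁ := ht₁
  refine ⟨fun t ht ε hε => ?_, max M N, fun t ht => ?_⟩
  · rcases le_or_gt t t₁ with h | h
    · obtain ⟨δ, hδ, hd⟩ := hF t ht ε hε
      refine ⟨min δ (g.jump t₁), lt_min hδ hj, fun s hs hst => ?_⟩
      have hs₁ : s ≤ t₁ := by
        by_contra! hlt
        have h1 := g.add_jump_le hlt
        have h2 := g.mono' h
        have h3 := (abs_lt.1 hst).1
        have h4 := min_le_right δ (g.jump t₁)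
        change g t ≤ g t₁ at h2
        linarith
      rw [glue_of_le h, glue_of_le hs₁]
      exact hd s hs (hst.trans_le (min_le_left _ _))
    · obtain ⟨δ, hδ, hd⟩ := hG t ht ε hε
      refine ⟨min δ (g.jump t₁), lt_min hδ hj, fun s hs hst => ?_⟩
      have hs₁ : t₁ < s := by
        by_contra! hlt
        have h1 := g.add_jump_le h
        have h2 := g.mono' hlt
        have h3 := (abs_lt.1 hst).2
        have h4 := min_le_right δ (g.jump t₁)
        change g s ≤ g t₁ at h2
        linarith
      rw [glue_of_lt h, glue_of_lt hs₁]
      exact hd s hs (hst.trans_le (min_le_left _ _))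
  · rcases le_or_gt t t₁ with h | h
    · rw [glue_of_le h]; exact (hM t ht).trans (le_max_left _ _)
    · rw [glue_of_lt h]; exact (hN t ht).trans (le_max_right _ _)

/-! ### Rules for the `g`-derivative -/

/-- `F` has the `g`-derivative `L` at `t`. -/
def HasGDeriv (g : Derivator) (T : ℝ) (F : ℝ → ℂ) (t : ℝ) (L : ℂ) : Prop :=
  Tendsto (g.quot F t) (g.derivFilter T t) (𝓝 L)

namespace HasGDeriv

variable {L K : ℂ}

theorem deriv_eq (h : g.HasGDeriv T F t L) (H : g.GoodInterval T) (ht : t ∈ Icc 0 T) :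
    g.deriv T F t = L := by
  have := H.derivFilter_neBot ht
  exact Tendsto.limUnder_eq h

theorem congr (h : g.HasGDeriv T F t L) (H : g.GoodInterval T) (ht : t ∈ Icc 0 T)
    (he : EqOn F G (Icc 0 T)) : g.HasGDeriv T G t L := by
  refine Tendsto.congr' ?_ h
  filter_upwards [H.eventually_derivFilter ht] with s hs
  simp only [quot, he hs.1, he (H.star_mem ht)]

theorem add (h : g.HasGDeriv T F t L) (h' : g.HasGDeriv T G t K) :
    g.HasGDeriv T (fun s => F s + G s) t (L + K) := by
  refine (Tendsto.add h h').congr fun s => ?_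
  simp only [quot]; ring

theorem const_mul (h : g.HasGDeriv T F t L) (c : ℂ) :
    g.HasGDeriv T (fun s => c * F s) t (c * L) := by
  refine (Tendsto.const_mul c h).congr fun s => ?_
  simp only [quot]; ring

theorem tendsto (h : g.HasGDeriv T F t L) (H : g.GoodInterval T) (ht : t ∈ Icc 0 T) :
    Tendsto F (g.derivFilter T t) (𝓝 (F (g.star t) + L * g.jump (g.star t))) := by
  have h1 := (Tendsto.mul h
    ((Complex.continuous_ofReal.tendsto _).comp (H.tendsto_sub ht))).const_add (F (g.star t))
  exact h1.congr' ((H.eventually_eq_add_quot_mul ht F).mono fun s hs => hs.symm)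

/-- In the Leibniz splitting the factor `F s` tends to `F(t*) + L Δg(t*)` rather than to `F(t*)`,
whence the term `L K Δg(t*)`. -/
theorem mul (h : g.HasGDeriv T F t L) (h' : g.HasGDeriv T G t K) (H : g.GoodInterval T)
    (ht : t ∈ Icc 0 T) : g.HasGDeriv T (fun s => F s * G s) t
      (L * G (g.star t) + F (g.star t) * K + L * K * g.jump (g.star t)) := by
  have h1 := (Tendsto.mul_const (G (g.star t)) h).add (Tendsto.mul (h.tendsto H ht) h')
  have e : L * G (g.star t) + F (g.star t) * K + L * K * g.jump (g.star t) =
    L * G (g.star t) + (F (g.star t) + L * g.jump (g.star t)) * K := by ring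
  rw [e]
  refine h1.congr fun s => ?_
  simp only [quot]; ring

/-- If `t* = t₁`, the quotient compares `F t₁` with the right limit `G t₁ + K Δg(t₁)` of `G`. By
`hm` this is also the right limit of `F`, so the limit is `L`; the values `F t₁` and `G t₁` may
differ. -/
theorem glue (H : g.GoodInterval T) (ht : t ∈ Icc 0 T) (ht₁ : t₁ ∈ g.jumpSet)
    (h : g.HasGDeriv T F t L) (h' : g.HasGDeriv T G t K)
    (hm : g.star t = t₁ → F t₁ + L * g.jump t₁ = G t₁ + K * g.jump t₁) :
    g.HasGDeriv T (glue t₁ F G) t (if t ≤ t₁ then L else K) := by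
  rcases lt_trichotomy (g.star t) t₁ with hb | hb | hb
  · rw [if_pos ((H.star_le_iff ht ht₁).1 hb.le)]
    refine Tendsto.congr' ?_ h
    filter_upwards [H.derivFilter_le ht (Iio_mem_nhds hb)] with s hs
    simp only [quot, glue_of_le hb.le, glue_of_le (le_of_lt hs)]
  · rw [if_pos ((H.star_le_iff ht ht₁).1 hb.le)]
    have hj : ((g.jump t₁ : ℝ) : ℂ) ≠ 0 := Complex.ofReal_ne_zero.2 (ne_of_gt ht₁)
    have hl := H.derivFilter_le_nhdsGT ht (hb ▸ ht₁)
    have h1 := ((h'.tendsto H ht).sub_const (F t₁)).div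
      ((Complex.continuous_ofReal.tendsto _).comp (H.tendsto_sub ht)) (by rw [hb]; exact hj)
    rw [hb, ← hm hb, add_sub_cancel_left, mul_div_cancel_right₀ _ hj] at h1
    refine h1.congr' ?_
    filter_upwards [hl self_mem_nhdsWithin] with s hs
    rw [hb] at hs
    simp only [quot, hb, glue_of_le le_rfl, glue_of_lt hs, Function.comp, Pi.div_apply]
  · rw [if_neg fun h => not_le.2 hb ((H.star_le_iff ht ht₁).2 h)]
    refine Tendsto.congr' ?_ h'
    filter_upwards [H.derivFilter_le ht (Ioi_mem_nhds hb)] with s hs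
    simp only [quot, glue_of_lt hb, glue_of_lt hs]

/-- The increments of `F` to the right of `t` are controlled by the `g`-derivative at `t`. -/
theorem eventually_norm_sub_le (h : g.HasGDeriv T F t L) (H : g.GoodInterval T)
    (hF : g.ContOn T F) (ht : t ∈ Ico 0 T) {C : ℝ} (hC : ‖L‖ < C) :
    ∀ᶠ s in 𝓝[>] t, ‖F s - F t‖ ≤ C * (g s - g t) := by
  have ht' : t ∈ Icc 0 T := ⟨ht.1, ht.2.le⟩
  -- The difference quotient says nothing where `g s = g t`, but there `g`-continuity makes both
  -- sides vanish.
  have hz : ∀ s ∈ Icc 0 T, g s = g t → ‖F s - F t‖ ≤ C * (g s - g t) := fun s hs hg => by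
    rw [hF.eq_of_eq hs ht' hg, hg]; simp
  have hIcc : ∀ᶠ s in 𝓝[>] t, s ∈ Icc 0 T ∧ t < s := by
    filter_upwards [Ioc_mem_nhdsGT ht.2] with s hs
    exact ⟨⟨ht.1.trans hs.1.le, hs.2⟩, hs.1⟩
  by_cases hc : t ∈ g.constSet
  · filter_upwards [hIcc, (eventually_eq_of_mem_constSet hc).filter_mono nhdsWithin_le_nhds]
      with s hs hg
    exact hz s hs.1 hg
  have hb := H.star_eq ht' hc
  have hq : ∀ᶠ s in g.derivFilter T t, ‖g.quot F t s‖ < C :=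
    (Tendsto.norm h).eventually_lt_const hC
  have hq' : ∀ᶠ s in 𝓝[>] t, s ∈ Icc 0 T → g s ≠ g t → ‖g.quot F t s‖ < C := by
    unfold derivFilter at hq
    split_ifs at hq with hD
    · rw [hb, nhdsWithin_Ioc_eq_nhdsGT ht.2] at hq
      exact hq.mono fun s hs _ _ => hs
    · rw [eventually_nhdsWithin_iff] at hq
      exact (hq.filter_mono nhdsWithin_le_nhds).mono fun s hs h1 h2 => hs ⟨h1, h2⟩
  filter_upwards [hIcc, hq'] with s hs hqs
  by_cases hg : g s = g t
  · exact hz s hs.1 hg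
  · have hpos : 0 < g s - g t := sub_pos.2 (lt_of_le_of_ne (g.mono' hs.2.le) (Ne.symm hg))
    have h1 := (hqs hs.1 hg).le
    rw [quot, hb, norm_div, Complex.norm_real, Real.norm_of_nonneg hpos.le, div_le_iff₀ hpos] at h1
    exact h1

end HasGDeriv

/-! ### Uniqueness for the homogeneous system -/

theorem ContOn.norm_le_of_left (hF : g.ContOn T F) {φ : ℝ → ℝ} (hφ : ContinuousWithinAt φ (Iic t) t)
    (ht : t ∈ Ioc 0 T) (h : ∀ s ∈ Ico 0 t, ‖F s‖ ≤ φ s) : ‖F t‖ ≤ φ t := by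
  have h1 : ContinuousWithinAt F (Icc 0 t) t :=
    hF.continuousWithinAt ⟨ht.1.le, ht.2⟩ (Icc_subset_Icc_right ht.2)
      ((g.leftCts' t).mono fun _ hs => hs.2)
  have h2 : Tendsto F (𝓝[<] t) (𝓝 (F t)) := by
    rw [← nhdsWithin_Ico_eq_nhdsLT ht.1]
    exact h1.mono_left (nhdsWithin_mono _ Ico_subset_Icc_self)
  refine le_of_tendsto_of_tendsto h2.norm (hφ.mono_left (nhdsWithin_mono _ Iio_subset_Iic_self)) ?_
  filter_upwards [Ico_mem_nhdsLT ht.1] with s hs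
  exact h s hs

/-- A linear homogeneous system with zero initial values has only the zero solution. -/
theorem eq_zero_of_hasGDeriv (H : g.GoodInterval T) {q : ℝ → ℂ} {M : ℝ}
    (hF : g.ContOn T F) (hG : g.ContOn T G) (hq : ∀ t ∈ Icc 0 T, ‖q t‖ ≤ M)
    (hF' : ∀ t ∈ Icc 0 T, g.HasGDeriv T F t (G t))
    (hG' : ∀ t ∈ Icc 0 T, g.HasGDeriv T G t (q t * F t))
    (hF0 : F 0 = 0) (hG0 : G 0 = 0) : ∀ t ∈ Icc 0 T, F t = 0 := by
  -- The summand `1` makes `c` strictly larger than both Lipschitz constants `1` and `M`, since the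
  -- increment bound needs a strict inequality.
  set c := max 1 M + 1 with hc
  have key : ∀ ε > 0, ∀ t ∈ Icc 0 T,
      ‖F t‖ ≤ ε * Real.exp (c * g t) ∧ ‖G t‖ ≤ ε * Real.exp (c * g t) := by
    intro ε hε
    have hφ : ∀ t, ContinuousWithinAt (fun s => ε * Real.exp (c * g s)) (Iic t) t := fun t =>
      ContinuousWithinAt.mul continuousWithinAt_const
        (Real.continuous_exp.continuousAt.comp_continuousWithinAt
          (continuousWithinAt_const.mul (g.leftCts' t)))
    refine Real.interval_induction ?_ ?_ ?_
    · simp only [hF0, hG0, norm_zero]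
      constructor <;> positivity
    · exact fun s hs hr => ⟨ContOn.norm_le_of_left hF (hφ s) hs fun r hr' => (hr r hr').1,
        ContOn.norm_le_of_left hG (hφ s) hs fun r hr' => (hr r hr').2⟩
    · intro s hs hP
      have hs' : s ∈ Icc 0 T := ⟨hs.1, hs.2.le⟩
      set A := ε * Real.exp (c * g s) with hA
      have hApos : 0 < A := by positivity
      have hc1 : 1 < c := by have := le_max_left 1 M; linarith
      have hcM : M < c := by have := le_max_right 1 M; linarith
      have h1 : ‖G s‖ < c * A := hP.2.trans_lt (by nlinarith)
      have h2 : ‖q s * F s‖ < c * A := by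
        rw [norm_mul]
        refine (mul_le_mul (hq s hs') hP.1 (norm_nonneg _)
          ((norm_nonneg _).trans (hq s hs'))).trans_lt ?_
        nlinarith
      filter_upwards [(hF' s hs').eventually_norm_sub_le H hF hs h1,
        (hG' s hs').eventually_norm_sub_le H hG hs h2] with r hr1 hr2 _
      -- The inequality `1 + x ≤ exp x` holds for every `x`, so it also covers the increment `g r -
      -- g s` across a jump, which does not become small.
      have hexp : A + c * A * (g r - g s) ≤ ε * Real.exp (c * g r) := by
        have h3 := Real.add_one_le_exp (c * (g r - g s))
        have h4 : ε * Real.exp (c * g r) = A * Real.exp (c * (g r - g s)) := by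
          rw [hA, mul_assoc, ← Real.exp_add]; ring_nf
        rw [h4]
        nlinarith
      constructor
      · have := norm_le_norm_add_norm_sub' (F r) (F s)
        linarith [hP.1]
      · have := norm_le_norm_add_norm_sub' (G r) (G s)
        linarith [hP.2]
  intro t ht
  have h1 : Tendsto (fun ε : ℝ => ε * Real.exp (c * g t)) (𝓝[>] 0) (𝓝 0) := by
    have : Continuous fun ε : ℝ => ε * Real.exp (c * g t) := by fun_prop
    simpa using (this.tendsto 0).mono_left nhdsWithin_le_nhds
  refine norm_le_zero_iff.1 (ge_of_tendsto h1 ?_)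
  filter_upwards [self_mem_nhdsWithin] with ε hε
  exact (key ε hε t ht).1

end Derivator

/-! ### Integration against `μ_g` and the fundamental theorem -/

namespace Derivator

variable {g : Derivator} {T t t₁ : ℝ} {F G h k : ℝ → ℂ}

instance (g : Derivator) : IsLocallyFiniteMeasure g.measure := by
  unfold measure; infer_instance

theorem real_measure_Ico (g : Derivator) {a b : ℝ} (hab : a ≤ b) :
    g.measure.real (Ico a b) = g b - g a := by
  rw [Measure.real, measure_Ico, ENNReal.toReal_ofReal (sub_nonneg.2 (g.mono' hab))]

theorem stieltjesFunction_apply (g : Derivator) (t : ℝ) :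
    g.mono'.stieltjesFunction t = g t + g.jump t := by
  simp [Monotone.stieltjesFunction_eq, jump]

theorem real_measure_singleton (g : Derivator) (t : ℝ) : g.measure.real {t} = g.jump t := by
  rw [Measure.real, measure, StieltjesFunction.measure_singleton, leftLim_rightLim,
    stieltjesFunction_apply, add_sub_cancel_left, ENNReal.toReal_ofReal (g.jump_nonneg t)]

theorem real_measure_Ioo (g : Derivator) {a b : ℝ} (hab : a < b) :
    g.measure.real (Ioo a b) = g b - (g a + g.jump a) := by
  rw [Measure.real, measure, StieltjesFunction.measure_Ioo, leftLim_rightLim,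
    stieltjesFunction_apply, ENNReal.toReal_ofReal (sub_nonneg.2 (g.add_jump_le hab))]

theorem measurable_jump (g : Derivator) : Measurable g.jump := by
  have : g.jump = fun t => g.mono'.stieltjesFunction t - g t := by
    ext t; rw [stieltjesFunction_apply]; ring
  rw [this]
  exact g.mono'.stieltjesFunction.mono.measurable.sub g.mono'.measurable

/-- For any `r > s` the jump at `s` is at most `g r - g s`, which is small near a continuity point.
-/
theorem continuousAt_jump (ht : t ∉ g.jumpSet) : ContinuousAt g.jump t := by
  have hg := continuousAt_of_notMem ht
  rw [ContinuousAt, jump_eq_zero ht]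
  rw [Metric.tendsto_nhds]
  intro ε hε
  have h1 := Metric.tendsto_nhds.1 hg (ε / 2) (by linarith)
  obtain ⟨δ, hδ, hd⟩ := Metric.eventually_nhds_iff.1 h1
  filter_upwards [Ioo_mem_nhds (show t - δ < t by linarith) (show t < t + δ by linarith)] with s hs
  obtain ⟨r, hr1, hr2⟩ := exists_between hs.2
  have h2 := hd (show dist s t < δ by rw [Real.dist_eq, abs_lt]; constructor <;> linarith [hs.1, hs.2])
  have h3 := hd (show dist r t < δ by rw [Real.dist_eq, abs_lt]; constructor <;> linarith [hs.1])
  have h4 := g.add_jump_le hr1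
  have h5 := g.jump_nonneg s
  rw [Real.dist_eq, abs_lt] at h2 h3
  rw [Real.dist_eq, sub_zero, abs_of_nonneg h5]
  linarith [h2.1, h3.2]

/-- The preimage of an open set is the preimage under `g` of a union of balls, and the monotone `g`
is Borel. -/
theorem ContOn.measurable_restrict (hF : g.ContOn T F) : Measurable ((Icc 0 T).domRestrict F) := by
  refine measurable_of_isOpen fun U hU => ?_
  have key : ∀ t ∈ Icc 0 T, F t ∈ U → ∃ δ > 0, ∀ s ∈ Icc 0 T, |g t - g s| < δ → F s ∈ U := by
    intro t ht hFt
    obtain ⟨ε, hε, hb⟩ := Metric.isOpen_iff.1 hU _ hFt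
    obtain ⟨δ, hδ, hd⟩ := hF t ht ε hε
    refine ⟨δ, hδ, fun s hs hst => hb ?_⟩
    rw [Metric.mem_ball, dist_comm, dist_eq_norm]
    exact hd s hs hst
  choose! δ hδ hd using key
  have : (Icc 0 T).domRestrict F ⁻¹' U = (fun s : Icc (0 : ℝ) T => g s) ⁻¹'
      ⋃ t ∈ {t | t ∈ Icc 0 T ∧ F t ∈ U}, Metric.ball (g t) (δ t) := by
    ext s
    simp only [mem_preimage, mem_iUnion, Metric.mem_ball, exists_prop]
    constructor
    · intro hs
      exact ⟨s, ⟨s.2, hs⟩, by simpa using hδ s s.2 hs⟩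
    · rintro ⟨t, ht, hst⟩
      refine hd t ht.1 ht.2 s s.2 ?_
      rwa [dist_comm, Real.dist_eq] at hst
  rw [this]
  refine (g.mono'.measurable.comp measurable_subtype_coe) ?_
  exact (isOpen_biUnion fun t _ => Metric.isOpen_ball).measurableSet

/-- A bounded measurable function on `[0, T]` which is continuous at the continuity points of `g`. -/
structure Admissible (g : Derivator) (T : ℝ) (h : ℝ → ℂ) : Prop where
  meas : AEStronglyMeasurable h (g.measure.restrict (Icc 0 T))
  bdd : ∃ C, ∀ t ∈ Icc 0 T, ‖h t‖ ≤ C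
  cont : ∀ t ∈ Icc 0 T, t ∉ g.jumpSet → ContinuousWithinAt h (Icc 0 T) t

theorem MemBC.admissible (hF : g.MemBC T F) : g.Admissible T F where
  meas := by
    refine AEMeasurable.aestronglyMeasurable ?_
    exact aemeasurable_restrict_of_measurable_subtype measurableSet_Icc hF.1.measurable_restrict
  bdd := hF.2
  cont t ht hj := hF.1.continuousWithinAt ht le_rfl (continuousAt_of_notMem hj).continuousWithinAt

namespace Admissible

theorem congr (hh : g.Admissible T h) (he : EqOn h k (Icc 0 T)) : g.Admissible T k where
  meas := hh.meas.congr <| by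
    filter_upwards [ae_restrict_mem measurableSet_Icc] with s hs using he hs
  bdd := by
    obtain ⟨C, hC⟩ := hh.bdd
    exact ⟨C, fun t ht => he ht ▸ hC t ht⟩
  cont t ht hj := (hh.cont t ht hj).congr (fun s hs => (he hs).symm) (he ht).symm

theorem add (hh : g.Admissible T h) (hk : g.Admissible T k) :
    g.Admissible T fun t => h t + k t where
  meas := hh.meas.add hk.meas
  bdd := by
    obtain ⟨C, hC⟩ := hh.bdd
    obtain ⟨D, hD⟩ := hk.bdd
    exact ⟨C + D, fun t ht => (norm_add_le _ _).trans (add_le_add (hC t ht) (hD t ht))⟩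
  cont t ht hj := (hh.cont t ht hj).add (hk.cont t ht hj)

theorem mul (hh : g.Admissible T h) (hk : g.Admissible T k) :
    g.Admissible T fun t => h t * k t where
  meas := hh.meas.mul hk.meas
  bdd := by
    obtain ⟨C, hC⟩ := hh.bdd
    obtain ⟨D, hD⟩ := hk.bdd
    refine ⟨C * D, fun t ht => ?_⟩
    rw [norm_mul]
    exact mul_le_mul (hC t ht) (hD t ht) (norm_nonneg _) ((norm_nonneg _).trans (hC t ht))
  cont t ht hj := (hh.cont t ht hj).mul (hk.cont t ht hj)

theorem inv (hh : g.Admissible T h) (h1 : ∀ t ∈ Icc 0 T, 1 ≤ ‖h t‖) :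
    g.Admissible T fun t => (h t)⁻¹ where
  meas := hh.meas.aemeasurable.inv.aestronglyMeasurable
  bdd := ⟨1, fun t ht => by rw [norm_inv]; exact inv_le_one_of_one_le₀ (h1 t ht)⟩
  cont t ht hj := (hh.cont t ht hj).inv₀ (norm_pos_iff.1 (one_pos.trans_le (h1 t ht)))

/-- `Δg` is in general not `g`-continuous: if `g` increases strictly up to a jump point `t`, then
`Δg(s) → 0` as `s → t⁻` while `g s → g t`. Hence the integrands need a class wider than `BC_g`. -/
theorem jump (g : Derivator) (T : ℝ) : g.Admissible T fun t => (g.jump t : ℂ) where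
  meas := (Complex.measurable_ofReal.comp g.measurable_jump).aestronglyMeasurable
  bdd := by
    -- The argument `T + 1` accounts for a possible jump at `T`.
    refine ⟨g (T + 1) - g 0, fun t ht => ?_⟩
    rw [Complex.norm_real, Real.norm_of_nonneg (g.jump_nonneg t)]
    have h1 := g.add_jump_le (show t < T + 1 by linarith [ht.2])
    have h2 : g 0 ≤ g t := g.mono' ht.1
    linarith
  cont t _ hj := (Complex.continuous_ofReal.continuousAt.comp
    (continuousAt_jump hj)).continuousWithinAt

theorem integrableOn (hh : g.Admissible T h) {S : Set ℝ} (hS : S ⊆ Icc 0 T) :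
    IntegrableOn h S g.measure := by
  refine IntegrableOn.mono_set ?_ hS
  obtain ⟨C, hC⟩ := hh.bdd
  have : IsFiniteMeasure (g.measure.restrict (Icc 0 T)) :=
    ⟨by rw [Measure.restrict_apply_univ]; exact isCompact_Icc.measure_lt_top⟩
  refine Integrable.of_bound hh.meas C ?_
  filter_upwards [ae_restrict_mem measurableSet_Icc] with s hs using hC s hs

theorem integral_sub (hh : g.Admissible T h) {s : ℝ} (h0 : 0 ≤ t) (hts : t ≤ s) (hs : s ≤ T) :
    (∫ r in Ico 0 s, h r ∂g.measure) - ∫ r in Ico 0 t, h r ∂g.measure =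
      ∫ r in Ico t s, h r ∂g.measure := by
  rw [← Ico_union_Ico_eq_Ico h0 hts, setIntegral_union _ measurableSet_Ico, add_sub_cancel_left]
  · exact hh.integrableOn fun r hr => ⟨hr.1, by linarith [hr.2]⟩
  · exact hh.integrableOn fun r hr => ⟨by linarith [hr.1], by linarith [hr.2]⟩
  · exact Set.disjoint_left.2 fun r h1 h2 => not_lt.2 h2.1 h1.2

theorem integral_Ico (hh : g.Admissible T h) {s : ℝ} (h0 : 0 ≤ t) (hts : t < s) (hs : s ≤ T) :
    ∫ r in Ico t s, h r ∂g.measure = h t * g.jump t + ∫ r in Ioo t s, h r ∂g.measure := by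
  rw [← Ioo_insert_left hts, insert_eq, setIntegral_union _ measurableSet_Ioo, integral_singleton,
    real_measure_singleton, Complex.real_smul, mul_comm]
  · exact hh.integrableOn fun r hr => by rw [mem_singleton_iff.1 hr]; exact ⟨h0, by linarith⟩
  · exact hh.integrableOn fun r hr => ⟨by linarith [hr.1], by linarith [hr.2]⟩
  · exact Set.disjoint_left.2 fun r h1 h2 => h2.1.ne (mem_singleton_iff.1 h1).symm

theorem norm_integral_le {C : ℝ} {s : ℝ} (hC : ∀ r ∈ Ico t s, ‖h r‖ ≤ C) (hts : t ≤ s) :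
    ‖∫ r in Ico t s, h r ∂g.measure‖ ≤ C * (g s - g t) := by
  rw [← g.real_measure_Ico hts]
  refine norm_setIntegral_le_of_norm_le_const ?_ hC
  exact (measure_mono Ico_subset_Icc_self).trans_lt isCompact_Icc.measure_lt_top

/-- The primitive is Lipschitz as a function of `g`, with the bound of `h` as constant. -/
theorem memBC_integral (hh : g.Admissible T h) :
    g.MemBC T fun t => ∫ r in Ico 0 t, h r ∂g.measure := by
  obtain ⟨C, hC⟩ := hh.bdd
  have key : ∀ a b, 0 ≤ a → a ≤ b → b ≤ T →
      ‖(∫ r in Ico 0 b, h r ∂g.measure) - ∫ r in Ico 0 a, h r ∂g.measure‖ ≤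
        |C| * |g b - g a| := by
    intro a b ha hab hb
    rw [hh.integral_sub ha hab hb]
    refine (norm_integral_le (C := |C|) (fun r hr => (hC r ?_).trans (le_abs_self C)) hab).trans ?_
    · exact ⟨ha.trans hr.1, hr.2.le.trans hb⟩
    · gcongr; exact le_abs_self _
  refine ⟨fun t ht ε hε => ⟨ε / (|C| + 1), by positivity, fun s hs hst => ?_⟩,
    |C| * (g T - g 0), fun t ht => ?_⟩
  · have h1 : ‖(∫ r in Ico 0 t, h r ∂g.measure) - ∫ r in Ico 0 s, h r ∂g.measure‖ ≤
        |C| * |g t - g s| := by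
      rcases le_total s t with hle | hle
      · exact key s t hs.1 hle ht.2
      · rw [norm_sub_rev, abs_sub_comm]
        exact key t s ht.1 hle hs.2
    rw [lt_div_iff₀ (by positivity)] at hst
    nlinarith [abs_nonneg (g t - g s), abs_nonneg C]
  · refine (norm_integral_le (C := |C|) (fun r hr => (hC r ?_).trans (le_abs_self C)) ht.1).trans ?_
    · exact ⟨hr.1, hr.2.le.trans ht.2⟩
    · have : g t ≤ g T := g.mono' ht.2
      gcongr

/-- The fundamental theorem of calculus. -/
theorem hasGDeriv_integral (hh : g.Admissible T h) (H : g.GoodInterval T) (ht : t ∈ Icc 0 T) :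
    g.HasGDeriv T (fun t => ∫ r in Ico 0 t, h r ∂g.measure) t (h (g.star t)) := by
  set b := g.star t with hb
  have hbm := H.star_mem ht
  rw [← hb] at hbm
  obtain ⟨C, hC⟩ := hh.bdd
  by_cases hj : b ∈ g.jumpSet
  · have hjc : ((g.jump b : ℝ) : ℂ) ≠ 0 := Complex.ofReal_ne_zero.2 (ne_of_gt hj)
    have hbT := (H.mem_Ioo hbm hj).2
    have hl := H.derivFilter_le_nhdsGT ht hj
    -- The mass of `(b, s)` tends to zero, so only the atom at `b`, of mass `Δg(b)`, survives in the
    -- quotient.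
    have h0 : Tendsto (fun s => ∫ r in Ioo b s, h r ∂g.measure) (𝓝[>] b) (𝓝 0) := by
      have h1 : Tendsto (fun s => |C| * (g s - (g b + g.jump b))) (𝓝[>] b) (𝓝 0) := by
        simpa using ((g.tendsto_nhdsGT b).sub_const (g b + g.jump b)).const_mul |C|
      refine squeeze_zero_norm' ?_ h1
      filter_upwards [Ioc_mem_nhdsGT hbT] with s hs
      rw [← g.real_measure_Ioo hs.1]
      refine norm_setIntegral_le_of_norm_le_const ?_ fun r hr => (hC r ?_).trans (le_abs_self C)
      · exact (measure_mono Ioo_subset_Icc_self).trans_lt isCompact_Icc.measure_lt_top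
      · exact ⟨hbm.1.trans hr.1.le, hr.2.le.trans hs.2⟩
    have h2 := ((h0.mono_left hl).const_add (h b * g.jump b)).div
      ((Complex.continuous_ofReal.tendsto _).comp (H.tendsto_sub ht)) (by rw [← hb]; exact hjc)
    rw [← hb, add_zero, mul_div_cancel_right₀ _ hjc] at h2
    refine h2.congr' ?_
    filter_upwards [hl (Ioc_mem_nhdsGT hbT)] with s hs
    simp only [quot, ← hb, Function.comp, Pi.div_apply]
    rw [hh.integral_sub hbm.1 hs.1.le hs.2, hh.integral_Ico hbm.1 hs.1 hs.2]
  · have hcont := hh.cont b hbm hj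
    rw [HasGDeriv, Metric.tendsto_nhds]
    intro ε hε
    obtain ⟨δ, hδ, hd⟩ := Metric.continuousWithinAt_iff.1 hcont (ε / 2) (by linarith)
    -- Stated for an arbitrary interval near `b`, since without a jump `s` may approach `b` from
    -- either side.
    have key : ∀ a c, 0 ≤ a → a ≤ c → c ≤ T → (∀ r ∈ Ico a c, dist r b < δ) →
        ‖((∫ r in Ico 0 c, h r ∂g.measure) - ∫ r in Ico 0 a, h r ∂g.measure) -
          h b * ((g c - g a : ℝ) : ℂ)‖ ≤ ε / 2 * (g c - g a) := by
      intro a c ha hac hc hr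
      have hsub : Ico a c ⊆ Icc 0 T := fun r hr => ⟨ha.trans hr.1, hr.2.le.trans hc⟩
      have hconst : ∫ _ in Ico a c, h b ∂g.measure = h b * ((g c - g a : ℝ) : ℂ) := by
        rw [setIntegral_const, g.real_measure_Ico hac, Complex.real_smul, mul_comm]
      rw [hh.integral_sub ha hac hc, ← hconst, ← MeasureTheory.integral_sub]
      · refine norm_integral_le (fun r hr' => ?_) hac
        rw [← dist_eq_norm]
        exact (hd (hsub hr') (hr r hr')).le
      · exact hh.integrableOn hsub
      · exact (memBC_const (g := g) (T := T) (h b)).admissible.integrableOn hsub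
    filter_upwards [H.eventually_derivFilter ht,
      H.derivFilter_le ht (Metric.ball_mem_nhds _ hδ)] with s hs hsb
    rw [← hb] at hs hsb
    have hne : g s - g b ≠ 0 := sub_ne_zero.2 hs.2
    have hnec : ((g s - g b : ℝ) : ℂ) ≠ 0 := Complex.ofReal_ne_zero.2 hne
    rw [Metric.mem_ball, Real.dist_eq, abs_lt] at hsb
    have h3 : ‖((∫ r in Ico 0 s, h r ∂g.measure) - ∫ r in Ico 0 b, h r ∂g.measure) -
          h b * ((g s - g b : ℝ) : ℂ)‖ ≤ ε / 2 * |g s - g b| := by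
      rcases le_total b s with hle | hle
      · refine (key b s hbm.1 hle hs.1.2 fun r hr => ?_).trans
          (by gcongr; exact le_abs_self _)
        rw [Real.dist_eq, abs_lt]; constructor <;> linarith [hr.1, hr.2]
      · have := key s b hs.1.1 hle hbm.2 fun r hr => by
          rw [Real.dist_eq, abs_lt]; constructor <;> linarith [hr.1, hr.2]
        rw [← norm_neg]
        refine (le_of_eq ?_).trans (this.trans (by rw [abs_sub_comm]; gcongr; exact le_abs_self _))
        congr 1; push_cast; ring
    have h4 : g.quot (fun t => ∫ r in Ico 0 t, h r ∂g.measure) t s - h b =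
        (((∫ r in Ico 0 s, h r ∂g.measure) - ∫ r in Ico 0 b, h r ∂g.measure) -
          h b * ((g s - g b : ℝ) : ℂ)) / ((g s - g b : ℝ) : ℂ) := by
      rw [quot, ← hb, eq_div_iff hnec, sub_mul, div_mul_cancel₀ _ hnec]
    rw [dist_eq_norm, h4, norm_div, Complex.norm_real, Real.norm_eq_abs,
      div_lt_iff₀ (abs_pos.2 hne)]
    have := abs_pos.2 hne
    nlinarith

end Admissible

end Derivator

/-! ### The logarithm on the half plane `Re (1 + z) ≥ 1` -/

/-- The function `log (1 + z) / z`, extended continuously to `z = 0`. -/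
noncomputable def Complex.logQuot (z : ℂ) : ℂ := if z = 0 then 1 else Complex.log (1 + z) / z

namespace Complex

theorem measurable_logQuot : Measurable logQuot :=
  Measurable.ite (measurableSet_singleton 0) measurable_const
    ((measurable_log.comp (measurable_const.add measurable_id)).div measurable_id)

theorem hasDerivAt_log_one_add {z : ℂ} (hz : 0 ≤ z.re) :
    HasDerivAt (fun z => log (1 + z)) (1 + z)⁻¹ z := by
  have h : 1 + z ∈ slitPlane := Or.inl (by simp; linarith)
  simpa using ((hasDerivAt_id z).const_add 1).clog h

theorem one_le_norm_one_add {z : ℂ} (hz : 0 ≤ z.re) : 1 ≤ ‖1 + z‖ := by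
  refine le_trans ?_ (re_le_norm _)
  simp [hz]

/-- `logQuot` is the difference quotient of `log (1 + z)` at `0`, completed by the derivative there.
-/
theorem continuousAt_logQuot : ContinuousAt logQuot 0 := by
  have h0 := hasDerivAt_log_one_add (z := 0) le_rfl
  have h : logQuot = dslope (fun z => log (1 + z)) 0 := by
    ext z
    rcases eq_or_ne z 0 with rfl | hz
    · rw [dslope_same, h0.deriv, logQuot, if_pos rfl, add_zero, inv_one]
    · rw [dslope_of_ne _ hz, slope_def_field, logQuot, if_neg hz]; simp
  rw [h]
  exact continuousAt_dslope_same.2 h0.differentiableAt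

/-- Mean value inequality on a convex half plane where the derivative `1 / (1 + z)` has norm at most
`1`. -/
theorem norm_logQuot_le {z : ℂ} (hz : 0 ≤ z.re) : ‖logQuot z‖ ≤ 1 := by
  unfold logQuot
  split_ifs with h
  · simp
  have hconv : Convex ℝ {z : ℂ | 0 ≤ z.re} := convex_halfSpace_re_ge 0
  have := hconv.norm_image_sub_le_of_norm_hasDerivWithin_le
    (f := fun z => log (1 + z)) (f' := fun z => (1 + z)⁻¹) (C := 1) (x := 0) (y := z)
    (fun w hw => (hasDerivAt_log_one_add hw).hasDerivWithinAt)
    (fun w hw => by rw [norm_inv]; exact inv_le_one_of_one_le₀ (one_le_norm_one_add hw))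
    (show (0 : ℝ) ≤ (0 : ℂ).re from le_rfl) hz
  rw [norm_div, div_le_one (norm_pos_iff.2 h)]
  simpa using this

/-- Both factors have argument in `(-π/2, π/2)`, so the sum of the arguments stays inside the
principal branch. -/
theorem log_one_add_add_log_one_sub {z w : ℂ} (hz : z.re = 0) (hw : w = -z) :
    log (1 + z) + log (1 + w) = log ((1 + z) * (1 + w)) := by
  subst hw
  have h1 : |arg (1 + z)| < Real.pi / 2 := abs_arg_lt_pi_div_two_iff.2 (Or.inl (by simp [hz]))
  have h2 : |arg (1 + -z)| < Real.pi / 2 := abs_arg_lt_pi_div_two_iff.2 (Or.inl (by simp [hz]))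
  rw [abs_lt] at h1 h2
  refine (log_mul ?_ ?_ ⟨by linarith, by linarith⟩).symm
  · exact norm_pos_iff.1 (one_pos.trans_le (one_le_norm_one_add hz.ge))
  · exact norm_pos_iff.1 (one_pos.trans_le (one_le_norm_one_add (by simp [hz])))

end Complex

/-! ### The `g`-exponential -/

namespace Derivator

variable {g : Derivator} {T t t₁ : ℝ} {p u : ℝ → ℂ}

/-- Off jumps this is the ordinary chain rule. At a jump, `exp ∘ u` is multiplied by `exp(L Δg)`,
and `h1` rewrites this factor as `1 + M Δg`; the definition of `p̃` is made so that `h1` holds with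
`L = p̃`, `M = p`. -/
theorem HasGDeriv.cexp {L M : ℂ} (hu : g.HasGDeriv T u t L) (H : g.GoodInterval T)
    (ht : t ∈ Icc 0 T) (h0 : g.jump (g.star t) = 0 → M = L)
    (h1 : Complex.exp (L * g.jump (g.star t)) = 1 + M * g.jump (g.star t)) :
    g.HasGDeriv T (fun s => Complex.exp (u s)) t (M * Complex.exp (u (g.star t))) := by
  have hlim := hu.tendsto H ht
  set b := g.star t with hb
  by_cases hj : g.jump b = 0
  · rw [hj, Complex.ofReal_zero, mul_zero, add_zero] at hlim
    have hd : ContinuousAt (dslope Complex.exp (u b)) (u b) :=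
      continuousAt_dslope_same.2 Complex.differentiableAt_exp
    have h2 := (hd.tendsto.comp hlim).mul hu
    rw [dslope_same, Complex.deriv_exp, mul_comm, ← h0 hj] at h2
    refine h2.congr fun s => ?_
    have h3 := sub_smul_dslope Complex.exp (u b) (u s)
    simp only [quot, ← hb, Function.comp, ← h3, smul_eq_mul]
    ring
  · have hjc : ((g.jump b : ℝ) : ℂ) ≠ 0 := Complex.ofReal_ne_zero.2 hj
    have h2 := (((Complex.continuous_exp.tendsto _).comp hlim).sub_const (Complex.exp (u b))).div
      ((Complex.continuous_ofReal.tendsto _).comp (H.tendsto_sub ht)) (by rw [← hb]; exact hjc)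
    have h3 : (Complex.exp (u b + L * g.jump b) - Complex.exp (u b)) / g.jump b =
        M * Complex.exp (u b) := by
      rw [Complex.exp_add, h1, div_eq_iff hjc]; ring
    rw [← hb, h3] at h2
    exact h2

/-- Removes the case distinction on `D_g`: measurability, boundedness and continuity off `D_g` pass
from `logQuot` to `p̃`. -/
theorem expIntegrand_eq (g : Derivator) (p : ℝ → ℂ) (s : ℝ) :
    g.expIntegrand p s = p s * Complex.logQuot (p s * g.jump s) := by
  unfold expIntegrand Complex.logQuot
  split_ifs with h1 h2 h2
  · have hj : ((g.jump s : ℝ) : ℂ) ≠ 0 := Complex.ofReal_ne_zero.2 (ne_of_gt h1)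
    rw [h2]
    rcases mul_eq_zero.1 h2 with h | h
    · simp [h]
    · exact absurd h hj
  · have hp : p s ≠ 0 := left_ne_zero_of_mul h2
    rw [mul_div_assoc', mul_div_mul_left _ _ hp]
  · simp
  · exact absurd (by rw [jump_eq_zero h1]; simp) h2

/-- An admissible exponent `p` for which `1 + p Δg` stays in the half plane `Re ≥ 1`. -/
structure GoodExponent (g : Derivator) (T : ℝ) (p : ℝ → ℂ) : Prop where
  admissible : g.Admissible T p
  re_nonneg : ∀ t ∈ Icc 0 T, 0 ≤ (p t * g.jump t).re

namespace GoodExponent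

theorem one_le_norm (hp : g.GoodExponent T p) (ht : t ∈ Icc 0 T) : 1 ≤ ‖1 + p t * g.jump t‖ :=
  Complex.one_le_norm_one_add (hp.re_nonneg t ht)

theorem one_add_ne_zero (hp : g.GoodExponent T p) (ht : t ∈ Icc 0 T) : 1 + p t * g.jump t ≠ 0 :=
  norm_pos_iff.1 (one_pos.trans_le (hp.one_le_norm ht))

theorem admissible_inv (hp : g.GoodExponent T p) :
    g.Admissible T fun t => (1 + p t * g.jump t)⁻¹ :=
  ((memBC_const 1).admissible.add (hp.admissible.mul (Admissible.jump g T))).inv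
    fun _ ht => hp.one_le_norm ht

theorem admissible_expIntegrand (hp : g.GoodExponent T p) :
    g.Admissible T (g.expIntegrand p) := by
  have hpj := hp.admissible.mul (Admissible.jump g T)
  refine (hp.admissible.mul (k := fun t => Complex.logQuot (p t * g.jump t)) ⟨?_, ?_, ?_⟩).congr
    fun t _ => (g.expIntegrand_eq p t).symm
  · exact (Complex.measurable_logQuot.comp_aemeasurable hpj.meas.aemeasurable).aestronglyMeasurable
  · exact ⟨1, fun t ht => Complex.norm_logQuot_le (hp.re_nonneg t ht)⟩
  · intro t ht hj
    refine ContinuousAt.comp_continuousWithinAt (g := Complex.logQuot)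
      (f := fun t => p t * g.jump t) ?_ (hpj.cont t ht hj)
    rw [jump_eq_zero hj, Complex.ofReal_zero, mul_zero]
    exact Complex.continuousAt_logQuot

theorem regressiveIntegrable (hp : g.GoodExponent T p) :
    g.RegressiveIntegrable T p ∧ IntegrableOn (g.expIntegrand p) (Ico 0 T) g.measure :=
  ⟨⟨fun _ ht => hp.one_add_ne_zero ht.1, hp.admissible.integrableOn Ico_subset_Icc_self⟩,
    hp.admissible_expIntegrand.integrableOn Ico_subset_Icc_self⟩

theorem exp_expIntegrand_mul_jump (hp : g.GoodExponent T p) (ht : t ∈ Icc 0 T) :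
    Complex.exp (g.expIntegrand p t * g.jump t) = 1 + p t * g.jump t := by
  by_cases hj : t ∈ g.jumpSet
  · rw [expIntegrand, if_pos hj, div_mul_cancel₀ _ (Complex.ofReal_ne_zero.2 (ne_of_gt hj)),
      Complex.exp_log (hp.one_add_ne_zero ht)]
  · simp [jump_eq_zero hj]

theorem memBC_gexp (hp : g.GoodExponent T p) : g.MemBC T (g.gexp p) :=
  hp.admissible_expIntegrand.memBC_integral.cexp

theorem memBC_inv_gexp (hp : g.GoodExponent T p) : g.MemBC T fun t => (g.gexp p t)⁻¹ := by
  refine (hp.admissible_expIntegrand.memBC_integral.const_mul (-1)).cexp.congr fun t _ => ?_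
  simp [gexp, Complex.exp_neg]

theorem hasGDeriv_gexp (hp : g.GoodExponent T p) (H : g.GoodInterval T) (ht : t ∈ Icc 0 T) :
    g.HasGDeriv T (g.gexp p) t (p (g.star t) * g.gexp p (g.star t)) := by
  refine (hp.admissible_expIntegrand.hasGDeriv_integral H ht).cexp H ht (fun hj => ?_)
    (hp.exp_expIntegrand_mul_jump (H.star_mem ht))
  rw [expIntegrand, if_neg fun h : _ ∈ g.jumpSet => (ne_of_gt h) hj]

/-- The atom at `t₁` contributes exactly the factor `exp(p̃ Δg) = 1 + p Δg`. -/
theorem gexp_split (hp : g.GoodExponent T p) (h₁ : 0 ≤ t₁) (h : t₁ < t) (ht : t ≤ T) :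
    g.gexp p t = g.gexp p t₁ * (1 + p t₁ * g.jump t₁) *
      Complex.exp (∫ s in Ioo t₁ t, g.expIntegrand p s ∂g.measure) := by
  have h1 := hp.admissible_expIntegrand.integral_sub h₁ h.le ht
  rw [hp.admissible_expIntegrand.integral_Ico h₁ h ht] at h1
  rw [gexp, gexp, ← hp.exp_expIntegrand_mul_jump ⟨h₁, h.le.trans ht⟩, ← Complex.exp_add,
    ← Complex.exp_add, eq_add_of_sub_eq h1]
  ring_nf

end GoodExponent

theorem gexp_ne_zero (g : Derivator) (p : ℝ → ℂ) (t : ℝ) : g.gexp p t ≠ 0 := Complex.exp_ne_zero _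

theorem gexp_zero (g : Derivator) (p : ℝ → ℂ) : g.gexp p 0 = 1 := by simp [gexp]

end Derivator

/-! ### The functions `y_k` and their Wronskian -/

namespace Helmholtz

open Derivator

variable {g : Derivator} {T t t₁ w₁ w₂ : ℝ} {f : ℝ → ℂ}

theorem w0_of_le (h : t ≤ t₁) : w0 t₁ w₁ w₂ t = w₁ := if_pos h

theorem w0_of_lt (h : t₁ < t) : w0 t₁ w₁ w₂ t = w₂ := if_neg (not_le.2 h)

theorem lam_zero (w : ℝ) : lam w 0 = Complex.I * w := if_pos rfl

theorem lam_one (w : ℝ) : lam w 1 = -(Complex.I * w) := if_neg one_ne_zero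

theorem lam_one_eq_neg (w : ℝ) : lam w 1 = -lam w 0 := by rw [lam_zero, lam_one]

theorem lam_sq (w : ℝ) (k : Fin 2) : lam w k ^ 2 = -(w : ℂ) ^ 2 := by
  unfold lam
  split_ifs <;> ring_nf <;> simp

theorem lam_one_sub_lam_zero_ne {w : ℝ} (hw : w ≠ 0) : lam w 1 - lam w 0 ≠ 0 := by
  have : lam w 1 - lam w 0 = -2 * Complex.I * w := by rw [lam_zero, lam_one]; ring
  rw [this]
  simp [hw]

theorem re_lam_mul (w : ℝ) (k : Fin 2) (r : ℝ) : (lam w k * r).re = 0 := by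
  unfold lam
  split_ifs <;> simp

theorem one_add_mul_one_add (w r : ℝ) :
    (1 + lam w 0 * r) * (1 + lam w 1 * r) = 1 + (w : ℂ) ^ 2 * (r : ℂ) ^ 2 := by
  have := lam_sq w 0
  rw [lam_one_eq_neg]
  linear_combination (-(r : ℂ) ^ 2) * this

theorem goodExponent_lam (g : Derivator) (T w : ℝ) (k : Fin 2) :
    g.GoodExponent T fun _ => lam w k :=
  ⟨(memBC_const _).admissible, fun t _ => (re_lam_mul w k (g.jump t)).ge⟩

theorem one_add_lam_mul_jump_ne_zero (g : Derivator) (w : ℝ) (k : Fin 2) (t : ℝ) :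
    1 + lam w k * g.jump t ≠ 0 :=
  norm_pos_iff.1 (one_pos.trans_le (Complex.one_le_norm_one_add (re_lam_mul w k _).ge))

theorem memBC_cexp (g : Derivator) (T w : ℝ) (k : Fin 2) : g.MemBC T (g.cexp (lam w k)) :=
  (goodExponent_lam g T w k).memBC_gexp

theorem cexp_ne_zero (g : Derivator) (l : ℂ) (t : ℝ) : g.cexp l t ≠ 0 := g.gexp_ne_zero _ _

theorem hasGDeriv_cexp (H : g.GoodInterval T) (ht : t ∈ Icc 0 T) (w : ℝ) (k : Fin 2) :
    g.HasGDeriv T (g.cexp (lam w k)) t (lam w k * g.cexp (lam w k) t) := by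
  have := (goodExponent_lam g T w k).hasGDeriv_gexp H ht
  rwa [(goodExponent_lam g T w k).memBC_gexp.apply_star H ht] at this

theorem memBC_w0 (ht₁ : t₁ ∈ g.jumpSet) (w₁ w₂ : ℝ) :
    g.MemBC T fun t => (w0 t₁ w₁ w₂ t : ℂ) := by
  refine (MemBC.glue ht₁ (memBC_const (w₁ : ℂ)) (memBC_const (w₂ : ℂ))).congr fun t _ => ?_
  rcases le_or_gt t t₁ with h | h
  · rw [glue_of_le h, w0_of_le h]
  · rw [glue_of_lt h, w0_of_lt h]

theorem memBC_w0_sq (ht₁ : t₁ ∈ g.jumpSet) (w₁ w₂ : ℝ) :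
    g.MemBC T fun t => (w0 t₁ w₁ w₂ t : ℂ) ^ 2 :=
  ((memBC_w0 ht₁ w₁ w₂).mul (memBC_w0 ht₁ w₁ w₂)).congr fun _ _ => (sq _).symm

theorem goodExponent_expo (ht₁ : t₁ ∈ g.jumpSet) (w₁ w₂ : ℝ) :
    g.GoodExponent T (expo g t₁ w₁ w₂) := by
  refine ⟨(memBC_w0_sq ht₁ w₁ w₂).admissible.mul (Admissible.jump g T), fun t _ => ?_⟩
  have : expo g t₁ w₁ w₂ t * g.jump t = ((w0 t₁ w₁ w₂ t ^ 2 * g.jump t * g.jump t : ℝ) : ℂ) := by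
    simp [expo]
  rw [this, Complex.ofReal_re, mul_assoc]
  exact mul_nonneg (sq_nonneg _) (mul_self_nonneg _)

theorem one_add_expo_mul_jump (g : Derivator) (t₁ w₁ w₂ t : ℝ) :
    1 + expo g t₁ w₁ w₂ t * g.jump t =
      1 + (w0 t₁ w₁ w₂ t : ℂ) ^ 2 * (g.jump t : ℂ) ^ 2 := by
  rw [expo]; ring

/-- At jumps the two logarithms add up to that of `1 + w₀² Δg²`; elsewhere the exponents `± i w₀`
cancel and `w₀² Δg` vanishes. Hence `E` factors into two exponentials on each side of `t₁`. -/
theorem expIntegrand_expo (g : Derivator) (t₁ w₁ w₂ t : ℝ) :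
    g.expIntegrand (expo g t₁ w₁ w₂) t =
      g.expIntegrand (fun _ => lam (w0 t₁ w₁ w₂ t) 0) t +
        g.expIntegrand (fun _ => lam (w0 t₁ w₁ w₂ t) 1) t := by
  unfold expIntegrand
  split_ifs with h
  · rw [← add_div, Complex.log_one_add_add_log_one_sub (re_lam_mul _ _ _)
      (by rw [lam_one_eq_neg]; ring), one_add_mul_one_add, one_add_expo_mul_jump]
  · rw [lam_one_eq_neg, expo, jump_eq_zero h]; simp

theorem gexp_expo_of_le (h : t ≤ t₁) :
    g.gexp (expo g t₁ w₁ w₂) t = g.cexp (lam w₁ 0) t * g.cexp (lam w₁ 1) t := by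
  rw [cexp, cexp, gexp, gexp, gexp, ← Complex.exp_add, ← integral_add]
  · congr 1
    refine setIntegral_congr_fun measurableSet_Ico fun s hs => ?_
    rw [expIntegrand_expo, w0_of_le (hs.2.le.trans h)]
  · exact (goodExponent_lam g t w₁ 0).regressiveIntegrable.2
  · exact (goodExponent_lam g t w₁ 1).regressiveIntegrable.2

theorem exp_integral_expo (h0 : 0 ≤ t₁) :
    Complex.exp (∫ s in Ioo t₁ t, g.expIntegrand (expo g t₁ w₁ w₂) s ∂g.measure) =
      Complex.exp (∫ s in Ioo t₁ t, g.expIntegrand (fun _ => lam w₂ 0) s ∂g.measure) *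
      Complex.exp (∫ s in Ioo t₁ t, g.expIntegrand (fun _ => lam w₂ 1) s ∂g.measure) := by
  have hsub : Ioo t₁ t ⊆ Icc 0 t := fun s hs => ⟨h0.trans hs.1.le, hs.2.le⟩
  rw [← Complex.exp_add, ← integral_add]
  · congr 1
    refine setIntegral_congr_fun measurableSet_Ioo fun s hs => ?_
    rw [expIntegrand_expo, w0_of_lt hs.1]
  · exact (goodExponent_lam g t w₂ 0).admissible_expIntegrand.integrableOn hsub
  · exact (goodExponent_lam g t w₂ 1).admissible_expIntegrand.integrableOn hsub

/-- The `g`-derivative of `yRight`. -/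
noncomputable def yRightDeriv (g : Derivator) (t₁ w₁ w₂ : ℝ) (k : Fin 2) (t : ℝ) : ℂ :=
  alpha1 g t₁ w₁ w₂ k * (lam w₂ 0 * g.cexp (lam w₂ 0) t) +
    alpha2 g t₁ w₁ w₂ k * (lam w₂ 1 * g.cexp (lam w₂ 1) t)

/-- The function `y_k`, without cutoff outside `[0, T]`. -/
noncomputable def sol (g : Derivator) (t₁ w₁ w₂ : ℝ) (k : Fin 2) : ℝ → ℂ :=
  glue t₁ (g.cexp (lam w₁ k)) (yRight g t₁ w₁ w₂ k)

/-- The `g`-derivative of `y_k`. -/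
noncomputable def solDeriv (g : Derivator) (t₁ w₁ w₂ : ℝ) (k : Fin 2) : ℝ → ℂ :=
  glue t₁ (fun t => lam w₁ k * g.cexp (lam w₁ k) t) (yRightDeriv g t₁ w₁ w₂ k)

theorem indicator_add_indicator_eq_glue (F G : ℝ → ℂ) (ht : t ∈ Icc 0 T) :
    (Icc 0 t₁).indicator F t + (Ioc t₁ T).indicator G t = glue t₁ F G t := by
  rcases le_or_gt t t₁ with h | h
  · rw [glue_of_le h, indicator_of_mem (mem_Icc.2 ⟨ht.1, h⟩), indicator_of_notMem fun h' => not_lt.2 h h'.1,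
      add_zero]
  · rw [glue_of_lt h, indicator_of_notMem fun h' => not_lt.2 h'.2 h, indicator_of_mem (mem_Ioc.2 ⟨h, ht.2⟩),
      zero_add]

theorem y_eqOn (g : Derivator) (T t₁ w₁ w₂ : ℝ) (k : Fin 2) :
    EqOn (sol g t₁ w₁ w₂ k) (y g T t₁ w₁ w₂ k) (Icc 0 T) := fun _ ht =>
  (indicator_add_indicator_eq_glue _ _ ht).symm

theorem memBC_yRight (g : Derivator) (T t₁ w₁ w₂ : ℝ) (k : Fin 2) :
    g.MemBC T (yRight g t₁ w₁ w₂ k) :=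
  ((memBC_cexp g T w₂ 0).const_mul _).add ((memBC_cexp g T w₂ 1).const_mul _)

theorem memBC_yRightDeriv (g : Derivator) (T t₁ w₁ w₂ : ℝ) (k : Fin 2) :
    g.MemBC T (yRightDeriv g t₁ w₁ w₂ k) :=
  (((memBC_cexp g T w₂ 0).const_mul _).const_mul _).add
    (((memBC_cexp g T w₂ 1).const_mul _).const_mul _)

theorem memBC_sol (ht₁ : t₁ ∈ g.jumpSet) (T w₁ w₂ : ℝ) (k : Fin 2) :
    g.MemBC T (sol g t₁ w₁ w₂ k) :=
  MemBC.glue ht₁ (memBC_cexp g T w₁ k) (memBC_yRight g T t₁ w₁ w₂ k)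

theorem memBC_solDeriv (ht₁ : t₁ ∈ g.jumpSet) (T w₁ w₂ : ℝ) (k : Fin 2) :
    g.MemBC T (solDeriv g t₁ w₁ w₂ k) :=
  MemBC.glue ht₁ ((memBC_cexp g T w₁ k).const_mul _) (memBC_yRightDeriv g T t₁ w₁ w₂ k)

/-- With `alpha2_mul`, this is Cramer's rule: the unknowns `α` times the right limits at `t₁` of the
exponentials for `λ₂¹, λ₂²` solve the Vandermonde system that matches value and derivative with
those of `exp_g(λ₁ᵏ; ·)`. -/
theorem alpha1_mul (g : Derivator) (t₁ w₁ w₂ : ℝ) (k : Fin 2) :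
    alpha1 g t₁ w₁ w₂ k * (g.cexp (lam w₂ 0) t₁ * (1 + lam w₂ 0 * g.jump t₁)) =
      g.cexp (lam w₁ k) t₁ * (1 + lam w₁ k * g.jump t₁) *
        ((lam w₂ 1 - lam w₁ k) / (lam w₂ 1 - lam w₂ 0)) := by
  have h1 := one_add_lam_mul_jump_ne_zero g w₂ 0 t₁
  have h2 := cexp_ne_zero g (lam w₂ 0) t₁
  rw [alpha1, mul_div_assoc', ← mul_div_mul_left _ (lam w₂ 1 - lam w₂ 0) (mul_ne_zero h2 h1),
    div_mul_eq_mul_div]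
  ring

theorem alpha2_mul (g : Derivator) (t₁ w₁ w₂ : ℝ) (k : Fin 2) :
    alpha2 g t₁ w₁ w₂ k * (g.cexp (lam w₂ 1) t₁ * (1 + lam w₂ 1 * g.jump t₁)) =
      g.cexp (lam w₁ k) t₁ * (1 + lam w₁ k * g.jump t₁) *
        ((lam w₁ k - lam w₂ 0) / (lam w₂ 1 - lam w₂ 0)) := by
  have h1 := one_add_lam_mul_jump_ne_zero g w₂ 1 t₁
  have h2 := cexp_ne_zero g (lam w₂ 1) t₁
  rw [alpha2, mul_div_assoc', ← mul_div_mul_left _ (lam w₂ 1 - lam w₂ 0) (mul_ne_zero h2 h1),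
    div_mul_eq_mul_div]
  ring

theorem hasGDeriv_yRight (H : g.GoodInterval T) (ht : t ∈ Icc 0 T) (k : Fin 2) :
    g.HasGDeriv T (yRight g t₁ w₁ w₂ k) t (yRightDeriv g t₁ w₁ w₂ k t) :=
  ((hasGDeriv_cexp H ht w₂ 0).const_mul _).add ((hasGDeriv_cexp H ht w₂ 1).const_mul _)

theorem hasGDeriv_yRightDeriv (H : g.GoodInterval T) (ht : t ∈ Icc 0 T) (k : Fin 2) :
    g.HasGDeriv T (yRightDeriv g t₁ w₁ w₂ k) t (-(w₂ : ℂ) ^ 2 * yRight g t₁ w₁ w₂ k t) := by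
  have h := (((hasGDeriv_cexp H ht w₂ 0).const_mul (lam w₂ 0)).const_mul
    (alpha1 g t₁ w₁ w₂ k)).add (((hasGDeriv_cexp H ht w₂ 1).const_mul (lam w₂ 1)).const_mul
    (alpha2 g t₁ w₁ w₂ k))
  refine (congrArg (g.HasGDeriv T (yRightDeriv g t₁ w₁ w₂ k) t) ?_).mp h
  rw [yRight]
  linear_combination (alpha1 g t₁ w₁ w₂ k * g.cexp (lam w₂ 0) t) * lam_sq w₂ 0 +
    alpha2 g t₁ w₁ w₂ k * g.cexp (lam w₂ 1) t * lam_sq w₂ 1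

/-- The right limits of `y_k` at `t₁` agree. -/
theorem sol_match (hw₂ : w₂ ≠ 0) (k : Fin 2) :
    yRight g t₁ w₁ w₂ k t₁ + yRightDeriv g t₁ w₁ w₂ k t₁ * g.jump t₁ =
      g.cexp (lam w₁ k) t₁ * (1 + lam w₁ k * g.jump t₁) := by
  have hd := lam_one_sub_lam_zero_ne hw₂
  have h : (lam w₂ 1 - lam w₁ k) / (lam w₂ 1 - lam w₂ 0) +
      (lam w₁ k - lam w₂ 0) / (lam w₂ 1 - lam w₂ 0) = 1 := by
    rw [← add_div, div_eq_one_iff_eq hd]; ring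
  rw [yRight, yRightDeriv]
  linear_combination alpha1_mul g t₁ w₁ w₂ k + alpha2_mul g t₁ w₁ w₂ k +
    g.cexp (lam w₁ k) t₁ * (1 + lam w₁ k * g.jump t₁) * h

/-- The right limits of the derivatives of `y_k` at `t₁` agree. -/
theorem solDeriv_match (hw₂ : w₂ ≠ 0) (k : Fin 2) :
    yRightDeriv g t₁ w₁ w₂ k t₁ + -(w₂ : ℂ) ^ 2 * yRight g t₁ w₁ w₂ k t₁ * g.jump t₁ =
      lam w₁ k * (g.cexp (lam w₁ k) t₁ * (1 + lam w₁ k * g.jump t₁)) := by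
  have hd := lam_one_sub_lam_zero_ne hw₂
  have h : lam w₂ 0 * ((lam w₂ 1 - lam w₁ k) / (lam w₂ 1 - lam w₂ 0)) +
      lam w₂ 1 * ((lam w₁ k - lam w₂ 0) / (lam w₂ 1 - lam w₂ 0)) = lam w₁ k := by
    field_simp; ring
  rw [yRight, yRightDeriv]
  linear_combination lam w₂ 0 * alpha1_mul g t₁ w₁ w₂ k + lam w₂ 1 * alpha2_mul g t₁ w₁ w₂ k +
    g.cexp (lam w₁ k) t₁ * (1 + lam w₁ k * g.jump t₁) * h -
    alpha1 g t₁ w₁ w₂ k * g.cexp (lam w₂ 0) t₁ * g.jump t₁ * lam_sq w₂ 0 -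
    alpha2 g t₁ w₁ w₂ k * g.cexp (lam w₂ 1) t₁ * g.jump t₁ * lam_sq w₂ 1

/-- The matching condition in `HasGDeriv.glue` involves derivatives at `t`; for `t* = t₁` this moves
them to `t₁`. -/
theorem apply_eq_of_star_eq {F : ℝ → ℂ} (hF : g.MemBC T F) (H : g.GoodInterval T)
    (ht : t ∈ Icc 0 T) (hb : g.star t = t₁) : F t = F t₁ := by
  rw [← hF.apply_star H ht, hb]

theorem hasGDeriv_sol (H : g.GoodInterval T) (ht₁ : t₁ ∈ g.jumpSet) (hw₂ : w₂ ≠ 0)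
    (ht : t ∈ Icc 0 T) (k : Fin 2) :
    g.HasGDeriv T (sol g t₁ w₁ w₂ k) t (solDeriv g t₁ w₁ w₂ k t) := by
  have h := (hasGDeriv_cexp H ht w₁ k).glue H ht ht₁
    (hasGDeriv_yRight (t₁ := t₁) (w₁ := w₁) (w₂ := w₂) H ht k) fun hb => by
      rw [apply_eq_of_star_eq (memBC_cexp g T w₁ k) H ht hb,
        apply_eq_of_star_eq (memBC_yRightDeriv g T t₁ w₁ w₂ k) H ht hb, sol_match hw₂]
      ring
  refine (congrArg (g.HasGDeriv T (sol g t₁ w₁ w₂ k) t) ?_).mp h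
  split_ifs with hle
  · exact (glue_of_le (F := fun t => lam w₁ k * g.cexp (lam w₁ k) t) hle).symm
  · exact (glue_of_lt (not_le.1 hle)).symm

theorem hasGDeriv_solDeriv (H : g.GoodInterval T) (ht₁ : t₁ ∈ g.jumpSet) (hw₂ : w₂ ≠ 0)
    (ht : t ∈ Icc 0 T) (k : Fin 2) :
    g.HasGDeriv T (solDeriv g t₁ w₁ w₂ k) t
      (-(w0 t₁ w₁ w₂ t : ℂ) ^ 2 * sol g t₁ w₁ w₂ k t) := by
  have h := ((hasGDeriv_cexp H ht w₁ k).const_mul (lam w₁ k)).glue H ht ht₁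
    (hasGDeriv_yRightDeriv (t₁ := t₁) (w₁ := w₁) (w₂ := w₂) H ht k) fun hb => by
      rw [apply_eq_of_star_eq (memBC_cexp g T w₁ k) H ht hb,
        apply_eq_of_star_eq (memBC_yRight g T t₁ w₁ w₂ k) H ht hb, solDeriv_match hw₂]
      ring
  refine (congrArg (g.HasGDeriv T (solDeriv g t₁ w₁ w₂ k) t) ?_).mp h
  split_ifs with hle
  · rw [sol, glue_of_le hle, w0_of_le hle, ← lam_sq w₁ k]; ring
  · rw [sol, glue_of_lt (not_le.1 hle), w0_of_lt (not_le.1 hle)]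

/-- The values of the exponentials to the right of `t₁`. -/
theorem cexp_split (h₁ : 0 ≤ t₁) (h : t₁ < t) (w : ℝ) (k : Fin 2) :
    g.cexp (lam w k) t = g.cexp (lam w k) t₁ * (1 + lam w k * g.jump t₁) *
      Complex.exp (∫ s in Ioo t₁ t, g.expIntegrand (fun _ => lam w k) s ∂g.measure) :=
  (goodExponent_lam g t w k).gexp_split h₁ h le_rfl

/-- The Wronskian of `y₁` and `y₂`. -/
theorem wronskian (ht₁ : t₁ ∈ g.jumpSet) (hw₂ : w₂ ≠ 0) (h₁ : 0 ≤ t₁) :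
    solDeriv g t₁ w₁ w₂ 1 t * sol g t₁ w₁ w₂ 0 t - solDeriv g t₁ w₁ w₂ 0 t * sol g t₁ w₁ w₂ 1 t =
      (lam w₁ 1 - lam w₁ 0) * g.gexp (expo g t₁ w₁ w₂) t := by
  rcases le_or_gt t t₁ with h | h
  · rw [gexp_expo_of_le h]
    simp only [sol, solDeriv, glue_of_le h]
    ring
  · have hd := lam_one_sub_lam_zero_ne hw₂
    -- Right of `t₁`, `E` equals its right limit at `t₁` times `X Y`, and `y_k`, `y_k'` are linear
    -- in `X, Y`; a rational identity in the `λ`'s remains. The atom at `t₁` carries `w₁`, because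
    -- `w₀(t₁) = w₁`.
    have hE := (goodExponent_expo (T := t) ht₁ w₁ w₂).gexp_split h₁ h le_rfl
    rw [exp_integral_expo h₁, gexp_expo_of_le le_rfl, one_add_expo_mul_jump, w0_of_le le_rfl,
      ← one_add_mul_one_add] at hE
    have hy0 := cexp_split (g := g) h₁ h w₂ 0
    have hy1 := cexp_split (g := g) h₁ h w₂ 1
    set X := Complex.exp (∫ s in Ioo t₁ t, g.expIntegrand (fun _ => lam w₂ 0) s ∂g.measure)
    set Y := Complex.exp (∫ s in Ioo t₁ t, g.expIntegrand (fun _ => lam w₂ 1) s ∂g.measure)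
    have hy : ∀ k, yRight g t₁ w₁ w₂ k t = g.cexp (lam w₁ k) t₁ * (1 + lam w₁ k * g.jump t₁) *
        ((lam w₂ 1 - lam w₁ k) / (lam w₂ 1 - lam w₂ 0) * X +
          (lam w₁ k - lam w₂ 0) / (lam w₂ 1 - lam w₂ 0) * Y) := fun k => by
      rw [yRight, hy0, hy1]
      linear_combination X * alpha1_mul g t₁ w₁ w₂ k + Y * alpha2_mul g t₁ w₁ w₂ k
    have hy' : ∀ k, yRightDeriv g t₁ w₁ w₂ k t =
        g.cexp (lam w₁ k) t₁ * (1 + lam w₁ k * g.jump t₁) *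
        (lam w₂ 0 * ((lam w₂ 1 - lam w₁ k) / (lam w₂ 1 - lam w₂ 0)) * X +
          lam w₂ 1 * ((lam w₁ k - lam w₂ 0) / (lam w₂ 1 - lam w₂ 0)) * Y) := fun k => by
      rw [yRightDeriv, hy0, hy1]
      linear_combination lam w₂ 0 * X * alpha1_mul g t₁ w₁ w₂ k +
        lam w₂ 1 * Y * alpha2_mul g t₁ w₁ w₂ k
    simp only [sol, solDeriv, glue_of_lt h, hE, hy, hy']
    field_simp
    ring

/-! ### Solutions, uniqueness and the homogeneous problem -/

/-- A function with the right `g`-derivatives on `[0, T]` is a solution. -/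
theorem isSolution_of_hasGDeriv (H : g.GoodInterval T) (ht₁ : t₁ ∈ g.jumpSet) (hf : g.MemBC T f)
    {F F' v : ℝ → ℂ} (hF : g.MemBC T F) (hF' : g.MemBC T F')
    (h : ∀ t ∈ Icc 0 T, g.HasGDeriv T F t (F' t))
    (h' : ∀ t ∈ Icc 0 T, g.HasGDeriv T F' t (f t - (w0 t₁ w₁ w₂ t : ℂ) ^ 2 * F t))
    (hv : EqOn F v (Icc 0 T)) :
    IsSolution g T t₁ w₁ w₂ f v ∧ EqOn F' (g.deriv T v) (Icc 0 T) := by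
  have e1 : EqOn F' (g.deriv T v) (Icc 0 T) := fun t ht =>
    (((h t ht).congr H ht hv).deriv_eq H ht).symm
  have e2 : EqOn (fun t => f t + -1 * ((w0 t₁ w₁ w₂ t : ℂ) ^ 2 * F t))
      (g.deriv T (g.deriv T v)) (Icc 0 T) := fun t ht => by
    rw [((h' t ht).congr H ht e1).deriv_eq H ht]; ring
  refine ⟨⟨⟨hF.congr hv, fun t ht => ⟨_, (h t ht).congr H ht hv⟩, hF'.congr e1,
    fun t ht => ⟨_, (h' t ht).congr H ht e1⟩, ?_⟩, fun t ht => ?_⟩, e1⟩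
  · exact (hf.add (((memBC_w0_sq ht₁ w₁ w₂).mul hF).const_mul (-1))).congr e2
  · rw [← e2 ht, ← hv ht]; ring

theorem hasGDeriv_deriv {v : ℝ → ℂ} (h : g.DiffAt T v t) :
    g.HasGDeriv T v t (g.deriv T v t) :=
  tendsto_nhds_limUnder h

/-- The difference `F = u - v` and its derivative `G` satisfy `F' = G`, `G' = -w₀² F` with zero
data, the forcing terms having cancelled. -/
theorem IsSolutionIVP.eqOn (H : g.GoodInterval T) (ht₁ : t₁ ∈ g.jumpSet) {x₀ v₀ : ℂ}
    {u v : ℝ → ℂ} (hu : IsSolutionIVP g T t₁ w₁ w₂ f x₀ v₀ u)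
    (hv : IsSolutionIVP g T t₁ w₁ w₂ f x₀ v₀ v) : EqOn u v (Icc 0 T) := by
  obtain ⟨⟨⟨hu1, hu2, hu3, hu4, hu5⟩, hu6⟩, hu7, hu8⟩ := hu
  obtain ⟨⟨⟨hv1, hv2, hv3, hv4, hv5⟩, hv6⟩, hv7, hv8⟩ := hv
  obtain ⟨-, M, hM⟩ := (memBC_w0_sq (T := T) ht₁ w₁ w₂).const_mul (-1)
  intro t ht
  have := eq_zero_of_hasGDeriv H (hu1.add (hv1.const_mul (-1))).1 (hu3.add (hv3.const_mul (-1))).1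
    hM (fun t ht => (hasGDeriv_deriv (hu2 t ht)).add ((hasGDeriv_deriv (hv2 t ht)).const_mul (-1)))
    (fun t ht => by
      have h := (hasGDeriv_deriv (hu4 t ht)).add ((hasGDeriv_deriv (hv4 t ht)).const_mul (-1))
      refine (congrArg (g.HasGDeriv T _ t) ?_).mp h
      linear_combination hu6 t ht - hv6 t ht)
    (by rw [hu7, hv7]; ring) (by rw [hu8, hv8]; ring) t ht
  linear_combination this

theorem isSolution_y (H : g.GoodInterval T) (ht₁ : t₁ ∈ g.jumpSet) (hw₂ : w₂ ≠ 0) (k : Fin 2) :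
    IsSolution g T t₁ w₁ w₂ (fun _ => 0) (y g T t₁ w₁ w₂ k) ∧
      EqOn (solDeriv g t₁ w₁ w₂ k) (g.deriv T (y g T t₁ w₁ w₂ k)) (Icc 0 T) :=
  isSolution_of_hasGDeriv H ht₁ (memBC_const 0) (memBC_sol ht₁ T w₁ w₂ k)
    (memBC_solDeriv ht₁ T w₁ w₂ k) (fun _ ht => hasGDeriv_sol H ht₁ hw₂ ht k)
    (fun t ht => by
      rw [zero_sub, ← neg_mul]
      exact hasGDeriv_solDeriv H ht₁ hw₂ ht k) (y_eqOn g T t₁ w₁ w₂ k)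

/-- The function `v_h`, without cutoff outside `[0, T]`. -/
noncomputable def homSol (g : Derivator) (t₁ w₁ w₂ : ℝ) (x₀ v₀ : ℂ) (t : ℝ) : ℂ :=
  (lam w₁ 1 * x₀ - v₀) / (lam w₁ 1 - lam w₁ 0) * sol g t₁ w₁ w₂ 0 t +
    (v₀ - lam w₁ 0 * x₀) / (lam w₁ 1 - lam w₁ 0) * sol g t₁ w₁ w₂ 1 t

/-- The `g`-derivative of `v_h`. -/
noncomputable def homSolDeriv (g : Derivator) (t₁ w₁ w₂ : ℝ) (x₀ v₀ : ℂ) (t : ℝ) : ℂ :=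
  (lam w₁ 1 * x₀ - v₀) / (lam w₁ 1 - lam w₁ 0) * solDeriv g t₁ w₁ w₂ 0 t +
    (v₀ - lam w₁ 0 * x₀) / (lam w₁ 1 - lam w₁ 0) * solDeriv g t₁ w₁ w₂ 1 t

theorem vh_eqOn (g : Derivator) (T t₁ w₁ w₂ : ℝ) (x₀ v₀ : ℂ) :
    EqOn (homSol g t₁ w₁ w₂ x₀ v₀) (vh g T t₁ w₁ w₂ x₀ v₀) (Icc 0 T) := fun t ht => by
  rw [homSol, vh, y_eqOn g T t₁ w₁ w₂ 0 ht, y_eqOn g T t₁ w₁ w₂ 1 ht]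

theorem memBC_homSol (ht₁ : t₁ ∈ g.jumpSet) (T w₁ w₂ : ℝ) (x₀ v₀ : ℂ) :
    g.MemBC T (homSol g t₁ w₁ w₂ x₀ v₀) :=
  ((memBC_sol ht₁ T w₁ w₂ 0).const_mul _).add ((memBC_sol ht₁ T w₁ w₂ 1).const_mul _)

theorem memBC_homSolDeriv (ht₁ : t₁ ∈ g.jumpSet) (T w₁ w₂ : ℝ) (x₀ v₀ : ℂ) :
    g.MemBC T (homSolDeriv g t₁ w₁ w₂ x₀ v₀) :=
  ((memBC_solDeriv ht₁ T w₁ w₂ 0).const_mul _).add ((memBC_solDeriv ht₁ T w₁ w₂ 1).const_mul _)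

theorem hasGDeriv_homSol (H : g.GoodInterval T) (ht₁ : t₁ ∈ g.jumpSet) (hw₂ : w₂ ≠ 0)
    (ht : t ∈ Icc 0 T) (x₀ v₀ : ℂ) :
    g.HasGDeriv T (homSol g t₁ w₁ w₂ x₀ v₀) t (homSolDeriv g t₁ w₁ w₂ x₀ v₀ t) :=
  ((hasGDeriv_sol H ht₁ hw₂ ht 0).const_mul _).add ((hasGDeriv_sol H ht₁ hw₂ ht 1).const_mul _)

theorem hasGDeriv_homSolDeriv (H : g.GoodInterval T) (ht₁ : t₁ ∈ g.jumpSet) (hw₂ : w₂ ≠ 0)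
    (ht : t ∈ Icc 0 T) (x₀ v₀ : ℂ) :
    g.HasGDeriv T (homSolDeriv g t₁ w₁ w₂ x₀ v₀) t
      (0 - (w0 t₁ w₁ w₂ t : ℂ) ^ 2 * homSol g t₁ w₁ w₂ x₀ v₀ t) := by
  have h := ((hasGDeriv_solDeriv (w₁ := w₁) H ht₁ hw₂ ht 0).const_mul
    ((lam w₁ 1 * x₀ - v₀) / (lam w₁ 1 - lam w₁ 0))).add
    ((hasGDeriv_solDeriv (w₁ := w₁) H ht₁ hw₂ ht 1).const_mul
      ((v₀ - lam w₁ 0 * x₀) / (lam w₁ 1 - lam w₁ 0)))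
  refine (congrArg (g.HasGDeriv T (homSolDeriv g t₁ w₁ w₂ x₀ v₀) t) ?_).mp h
  rw [homSol]; ring

theorem sol_zero (h₁ : 0 ≤ t₁) (k : Fin 2) : sol g t₁ w₁ w₂ k 0 = 1 := by
  rw [sol, glue_of_le h₁, cexp, gexp_zero]

theorem solDeriv_zero (h₁ : 0 ≤ t₁) (k : Fin 2) : solDeriv g t₁ w₁ w₂ k 0 = lam w₁ k := by
  rw [solDeriv, glue_of_le h₁, cexp, gexp_zero, mul_one]

theorem homSol_zero (hw₁ : w₁ ≠ 0) (h₁ : 0 ≤ t₁) (x₀ v₀ : ℂ) :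
    homSol g t₁ w₁ w₂ x₀ v₀ 0 = x₀ := by
  have hd := lam_one_sub_lam_zero_ne hw₁
  rw [homSol, sol_zero h₁, sol_zero h₁]
  field_simp; ring

theorem homSolDeriv_zero (hw₁ : w₁ ≠ 0) (h₁ : 0 ≤ t₁) (x₀ v₀ : ℂ) :
    homSolDeriv g t₁ w₁ w₂ x₀ v₀ 0 = v₀ := by
  have hd := lam_one_sub_lam_zero_ne hw₁
  rw [homSolDeriv, solDeriv_zero h₁, solDeriv_zero h₁]
  field_simp; ring

/-! ### Variation of parameters -/

/-- The factor `f / ((1 + w₀² Δg²) exp_g(w₀² Δg; ·))`. -/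
noncomputable def forcing (g : Derivator) (t₁ w₁ w₂ : ℝ) (f : ℝ → ℂ) (s : ℝ) : ℂ :=
  f s * ((1 + expo g t₁ w₁ w₂ s * g.jump s)⁻¹ * (g.gexp (expo g t₁ w₁ w₂) s)⁻¹)

/-- The integrand of `v_{p₁}`, with the explicit `g`-derivative of `y_k`. -/
noncomputable def kern (g : Derivator) (t₁ w₁ w₂ : ℝ) (f : ℝ → ℂ) (k : Fin 2) (s : ℝ) : ℂ :=
  (sol g t₁ w₁ w₂ k s + solDeriv g t₁ w₁ w₂ k s * g.jump s) * forcing g t₁ w₁ w₂ f s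

theorem integrandP_eqOn (H : g.GoodInterval T) (ht₁ : t₁ ∈ g.jumpSet) (hw₂ : w₂ ≠ 0)
    (f : ℝ → ℂ) (k : Fin 2) :
    EqOn (kern g t₁ w₁ w₂ f k) (integrandP g T t₁ w₁ w₂ f k) (Icc 0 T) := fun s hs => by
  rw [integrandP, kern, forcing, y_eqOn g T t₁ w₁ w₂ k hs,
    (isSolution_y (w₁ := w₁) H ht₁ hw₂ k).2 hs, one_add_expo_mul_jump, ← mul_inv, div_eq_mul_inv,
    mul_assoc]

theorem admissible_kern (ht₁ : t₁ ∈ g.jumpSet) (hf : g.MemBC T f) (w₁ w₂ : ℝ) (k : Fin 2) :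
    g.Admissible T (kern g t₁ w₁ w₂ f k) :=
  ((memBC_sol ht₁ T w₁ w₂ k).admissible.add
    ((memBC_solDeriv ht₁ T w₁ w₂ k).admissible.mul (Admissible.jump g T))).mul
    (hf.admissible.mul ((goodExponent_expo ht₁ w₁ w₂).admissible_inv.mul
      (goodExponent_expo ht₁ w₁ w₂).memBC_inv_gexp.admissible))

/-- The combination `(-c₁ y₁ + c₀ y₂) / (λ₁² - λ₁¹)` of variation of parameters, where
`c_k` is the integral of `kern k`. -/
noncomputable def varParam (g : Derivator) (t₁ w₁ w₂ : ℝ) (f : ℝ → ℂ) (Y : Fin 2 → ℝ → ℂ)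
    (t : ℝ) : ℂ :=
  (lam w₁ 1 - lam w₁ 0)⁻¹ * (-1 * (Y 0 t * ∫ s in Ico 0 t, kern g t₁ w₁ w₂ f 1 s ∂g.measure) +
    Y 1 t * ∫ s in Ico 0 t, kern g t₁ w₁ w₂ f 0 s ∂g.measure)

theorem memBC_varParam (ht₁ : t₁ ∈ g.jumpSet) (hf : g.MemBC T f) (w₁ w₂ : ℝ)
    {Y : Fin 2 → ℝ → ℂ} (hY : ∀ k, g.MemBC T (Y k)) : g.MemBC T (varParam g t₁ w₁ w₂ f Y) :=
  ((((hY 0).mul (admissible_kern ht₁ hf w₁ w₂ 1).memBC_integral).const_mul _).add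
    ((hY 1).mul (admissible_kern ht₁ hf w₁ w₂ 0).memBC_integral)).const_mul _

/-- The kernels stay fixed while `Y` is free, so one computation serves `v_p` (`Y = y`) and its
derivative (`Y = y'`). -/
theorem hasGDeriv_varParam (H : g.GoodInterval T) (ht₁ : t₁ ∈ g.jumpSet) (hf : g.MemBC T f)
    (w₁ w₂ : ℝ) {Y Y' : Fin 2 → ℝ → ℂ} (hY : ∀ k, g.MemBC T (Y k))
    (ht : t ∈ Icc 0 T) (hY' : ∀ k, g.HasGDeriv T (Y k) t (Y' k t)) :
    g.HasGDeriv T (varParam g t₁ w₁ w₂ f Y) t (varParam g t₁ w₁ w₂ f Y' t +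
      (lam w₁ 1 - lam w₁ 0)⁻¹ *
        (-(Y 0 t + Y' 0 t * g.jump (g.star t)) * kern g t₁ w₁ w₂ f 1 (g.star t) +
          (Y 1 t + Y' 1 t * g.jump (g.star t)) * kern g t₁ w₁ w₂ f 0 (g.star t))) := by
  have hk := fun k => admissible_kern ht₁ hf w₁ w₂ k
  have h := ((((hY' 0).mul ((hk 1).hasGDeriv_integral H ht) H ht).const_mul (-1)).add
    ((hY' 1).mul ((hk 0).hasGDeriv_integral H ht) H ht)).const_mul (lam w₁ 1 - lam w₁ 0)⁻¹
  refine (congrArg (g.HasGDeriv T (varParam g t₁ w₁ w₂ f Y) t) ?_).mp h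
  rw [(hk 0).memBC_integral.apply_star H ht, (hk 1).memBC_integral.apply_star H ht,
    (hY 0).apply_star H ht, (hY 1).apply_star H ht, varParam]
  ring

/-- Each kernel is `y_k + y_k' Δg` times a common factor, so the two extra terms cancel. -/
theorem hasGDeriv_varParam_sol (H : g.GoodInterval T) (ht₁ : t₁ ∈ g.jumpSet) (hf : g.MemBC T f)
    (hw₂ : w₂ ≠ 0) (ht : t ∈ Icc 0 T) :
    g.HasGDeriv T (varParam g t₁ w₁ w₂ f (sol g t₁ w₁ w₂)) t
      (varParam g t₁ w₁ w₂ f (solDeriv g t₁ w₁ w₂) t) := by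
  have hY := memBC_sol ht₁ T w₁ w₂
  have hY' := memBC_solDeriv ht₁ T w₁ w₂
  have h := hasGDeriv_varParam H ht₁ hf w₁ w₂ hY ht fun k => hasGDeriv_sol H ht₁ hw₂ ht k
  refine (congrArg (g.HasGDeriv T (varParam g t₁ w₁ w₂ f (sol g t₁ w₁ w₂)) t) ?_).mp h
  rw [← (hY 0).apply_star H ht, ← (hY 1).apply_star H ht, ← (hY' 0).apply_star H ht,
    ← (hY' 1).apply_star H ht, kern, kern]
  ring

/-- With `y_k'' = -w₀² y_k`, the expression `(y₂' + y₂'' Δg)(y₁ + y₁' Δg) - (y₁' + y₁'' Δg)(y₂ + y₂'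
Δg)` is the Wronskian times `1 + w₀² Δg²`, which cancels the denominator of the kernels and leaves
`f`. -/
theorem hasGDeriv_varParam_solDeriv (H : g.GoodInterval T) (ht₁ : t₁ ∈ g.jumpSet)
    (hf : g.MemBC T f) (hw₁ : w₁ ≠ 0) (hw₂ : w₂ ≠ 0) (h₁ : 0 ≤ t₁) (ht : t ∈ Icc 0 T) :
    g.HasGDeriv T (varParam g t₁ w₁ w₂ f (solDeriv g t₁ w₁ w₂)) t
      (f t - (w0 t₁ w₁ w₂ t : ℂ) ^ 2 * varParam g t₁ w₁ w₂ f (sol g t₁ w₁ w₂) t) := by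
  have hY := memBC_sol ht₁ T w₁ w₂
  have hY' := memBC_solDeriv ht₁ T w₁ w₂
  have h := hasGDeriv_varParam H ht₁ hf w₁ w₂ hY' ht
    (Y' := fun k t => -(w0 t₁ w₁ w₂ t : ℂ) ^ 2 * sol g t₁ w₁ w₂ k t)
    fun k => hasGDeriv_solDeriv H ht₁ hw₂ ht k
  refine (congrArg (g.HasGDeriv T (varParam g t₁ w₁ w₂ f (solDeriv g t₁ w₁ w₂)) t) ?_).mp h
  have hd := lam_one_sub_lam_zero_ne hw₁
  have hW := wronskian (t := g.star t) (w₁ := w₁) ht₁ hw₂ h₁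
  have hE := g.gexp_ne_zero (expo g t₁ w₁ w₂) (g.star t)
  have hj := (goodExponent_expo ht₁ w₁ w₂).one_add_ne_zero (H.star_mem ht)
  simp only [varParam]
  rw [← (hY 0).apply_star H ht, ← (hY 1).apply_star H ht, ← (hY' 0).apply_star H ht,
    ← (hY' 1).apply_star H ht, ← hf.apply_star H ht, ← (memBC_w0_sq ht₁ w₁ w₂).apply_star H ht,
    kern, kern, forcing]
  have he : expo g t₁ w₁ w₂ (g.star t) = (w0 t₁ w₁ w₂ (g.star t) : ℂ) ^ 2 * g.jump (g.star t) := rfl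
  have key : (lam w₁ 1 - lam w₁ 0)⁻¹ * (((lam w₁ 1 - lam w₁ 0) * g.gexp (expo g t₁ w₁ w₂) (g.star t)) *
      (1 + expo g t₁ w₁ w₂ (g.star t) * g.jump (g.star t))) *
      (f (g.star t) * ((1 + expo g t₁ w₁ w₂ (g.star t) * g.jump (g.star t))⁻¹ *
        (g.gexp (expo g t₁ w₁ w₂) (g.star t))⁻¹)) = f (g.star t) := by
    field_simp
  rw [← hW] at key
  -- The first two occurrences of `f(t*)` belong to the kernels; the third is the isolated forcing
  -- term.
  nth_rewrite 3 [← key]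
  rw [he]
  ring

/-- The integrand of `v_{p₁}` to the left of `t₁`. -/
theorem kern_of_le (h : t ≤ t₁) (f : ℝ → ℂ) :
    kern g t₁ w₁ w₂ f 1 t = integrandL g f (lam w₁ 0) t ∧
      kern g t₁ w₁ w₂ f 0 t = integrandL g f (lam w₁ 1) t := by
  have h0 := one_add_lam_mul_jump_ne_zero g w₁ 0 t
  have h1 := one_add_lam_mul_jump_ne_zero g w₁ 1 t
  have e0 := cexp_ne_zero g (lam w₁ 0) t
  have e1 := cexp_ne_zero g (lam w₁ 1) t
  -- The numerator is `exp_g(λ₁ᵏ; ·)(1 + λ₁ᵏ Δg)`, one of the two factors of the denominator, so the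
  -- exponential with the other index remains.
  simp only [kern, forcing, integrandL, sol, solDeriv, glue_of_le h, gexp_expo_of_le h,
    one_add_expo_mul_jump, w0_of_le h, ← one_add_mul_one_add]
  constructor <;> field_simp

/-- The integrand of `v_{p₁}` to the right of `t₁`. -/
theorem kern_of_lt (h : t₁ < t) (f : ℝ → ℂ) (k : Fin 2) :
    kern g t₁ w₁ w₂ f k t =
      alpha1 g t₁ w₁ w₂ k * integrandR g t₁ w₁ w₂ f (lam w₂ 0) (lam w₂ 1) t +
        alpha2 g t₁ w₁ w₂ k * integrandR g t₁ w₁ w₂ f (lam w₂ 1) (lam w₂ 0) t := by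
  have h0 := one_add_lam_mul_jump_ne_zero g w₂ 0 t
  have h1 := one_add_lam_mul_jump_ne_zero g w₂ 1 t
  have hE := g.gexp_ne_zero (expo g t₁ w₁ w₂) t
  simp only [kern, forcing, integrandR, sol, solDeriv, glue_of_lt h, one_add_expo_mul_jump,
    w0_of_lt h, ← one_add_mul_one_add, yRight, yRightDeriv]
  field_simp
  ring

theorem admissible_integrandL (hf : g.MemBC T f) (w : ℝ) (k : Fin 2) :
    g.Admissible T (integrandL g f (lam w k)) :=
  ((goodExponent_lam g T w k).memBC_inv_gexp.admissible.mul (hf.admissible.mul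
    (goodExponent_lam g T w k).admissible_inv)).congr fun s _ => by
      rw [integrandL, div_eq_mul_inv]; rfl

theorem admissible_integrandR (ht₁ : t₁ ∈ g.jumpSet) (hf : g.MemBC T f) (w₁ w₂ : ℝ)
    (k l : Fin 2) : g.Admissible T (integrandR g t₁ w₁ w₂ f (lam w₂ k) (lam w₂ l)) :=
  (((memBC_cexp g T w₂ k).admissible.mul ((goodExponent_lam g T w₂ l).admissible_inv.mul
    (goodExponent_expo ht₁ w₁ w₂).memBC_inv_gexp.admissible)).mul hf.admissible).congr fun s _ => by
      rw [integrandR, div_eq_mul_inv, mul_inv]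

/-- The cut isolates the atom at `t₁`, where the kernel still has its left-hand form; it is the
source of the separate `f(t₁) Δg(t₁)` term in `I_k`. -/
theorem integral_kern (ht₁ : t₁ ∈ g.jumpSet) (hf : g.MemBC T f) (w₁ w₂ : ℝ) (h₁ : 0 ≤ t₁)
    (h : t₁ < t) (ht : t ≤ T) (k : Fin 2) :
    ∫ s in Ico 0 t, kern g t₁ w₁ w₂ f k s ∂g.measure =
      (∫ s in Ico 0 t₁, kern g t₁ w₁ w₂ f k s ∂g.measure) + kern g t₁ w₁ w₂ f k t₁ * g.jump t₁ +
      alpha1 g t₁ w₁ w₂ k *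
        (∫ s in Ioo t₁ t, integrandR g t₁ w₁ w₂ f (lam w₂ 0) (lam w₂ 1) s ∂g.measure) +
      alpha2 g t₁ w₁ w₂ k *
        (∫ s in Ioo t₁ t, integrandR g t₁ w₁ w₂ f (lam w₂ 1) (lam w₂ 0) s ∂g.measure) := by
  have hk := admissible_kern ht₁ hf w₁ w₂ k
  have hsub : Ioo t₁ t ⊆ Icc 0 T := fun s hs => ⟨h₁.trans hs.1.le, hs.2.le.trans ht⟩
  have h1 := hk.integral_sub h₁ h.le ht
  rw [hk.integral_Ico h₁ h ht, setIntegral_congr_fun measurableSet_Ioo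
    (fun s hs => kern_of_lt (g := g) (w₁ := w₁) (w₂ := w₂) hs.1 f k), integral_add,
    integral_const_mul, integral_const_mul] at h1
  · linear_combination h1
  · exact ((admissible_integrandR ht₁ hf w₁ w₂ 0 1).integrableOn hsub).const_mul _
  · exact ((admissible_integrandR ht₁ hf w₁ w₂ 1 0).integrableOn hsub).const_mul _

/-- Both pieces of `v_p` come from a single formula on `[0, T]`, so `v_p` needs no matching argument
of its own at `t₁`. -/
theorem vp_eqOn (H : g.GoodInterval T) (ht₁ : t₁ ∈ g.jumpSet) (h₁ : 0 ≤ t₁) (hw₂ : w₂ ≠ 0)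
    (hf : g.MemBC T f) :
    EqOn (varParam g t₁ w₁ w₂ f (sol g t₁ w₁ w₂)) (vp g T t₁ w₁ w₂ f) (Icc 0 T) := by
  intro t ht
  rw [vp, indicator_add_indicator_eq_glue _ _ ht, varParam]
  rcases le_or_gt t t₁ with h | h
  · have hI : ∀ k, ∫ s in Ico 0 t, integrandP g T t₁ w₁ w₂ f k s ∂g.measure =
        ∫ s in Ico 0 t, kern g t₁ w₁ w₂ f k s ∂g.measure := fun k =>
      setIntegral_congr_fun measurableSet_Ico fun s hs =>
        (integrandP_eqOn H ht₁ hw₂ f k ⟨hs.1, hs.2.le.trans ht.2⟩).symm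
    rw [glue_of_le h, vp1, integral_neg, hI, hI, y_eqOn g T t₁ w₁ w₂ 0 ht,
      y_eqOn g T t₁ w₁ w₂ 1 ht]
    ring
  · have hL0 : ∫ s in Ico 0 t₁, kern g t₁ w₁ w₂ f 0 s ∂g.measure =
        ∫ s in Ico 0 t₁, integrandL g f (lam w₁ 1) s ∂g.measure :=
      setIntegral_congr_fun measurableSet_Ico fun s hs => (kern_of_le hs.2.le f).2
    have hL1 : ∫ s in Ico 0 t₁, kern g t₁ w₁ w₂ f 1 s ∂g.measure =
        ∫ s in Ico 0 t₁, integrandL g f (lam w₁ 0) s ∂g.measure :=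
      setIntegral_congr_fun measurableSet_Ico fun s hs => (kern_of_le hs.2.le f).1
    have hn : (lam w₁ 0 - lam w₁ 1) = -(lam w₁ 1 - lam w₁ 0) := by ring
    rw [glue_of_lt h, vp2, integral_kern ht₁ hf w₁ w₂ h₁ h ht.2,
      integral_kern ht₁ hf w₁ w₂ h₁ h ht.2, hL0, hL1, (kern_of_le le_rfl f).1,
      (kern_of_le le_rfl f).2, hn, div_neg, div_neg, integrandL, integrandL]
    simp only [sol, glue_of_lt h]
    ring

theorem formulasWellDefined (H : g.GoodInterval T) (ht₁ : t₁ ∈ g.jumpSet) (h₁ : t₁ ∈ Icc 0 T)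
    (hw₂ : w₂ ≠ 0) (hf : g.MemBC T f) : FormulasWellDefined g T t₁ w₁ w₂ f := by
  have hsub : Ioo t₁ T ⊆ Icc 0 T := fun s hs => ⟨h₁.1.trans hs.1.le, hs.2.le⟩
  refine ⟨fun k => (goodExponent_lam g T w₁ k).regressiveIntegrable,
    fun k => (goodExponent_lam g T w₂ k).regressiveIntegrable,
    (goodExponent_expo ht₁ w₁ w₂).regressiveIntegrable, fun k => ?_, fun k => ?_,
    (admissible_integrandR ht₁ hf w₁ w₂ 0 1).integrableOn hsub,
    (admissible_integrandR ht₁ hf w₁ w₂ 1 0).integrableOn hsub⟩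
  · exact ((admissible_kern ht₁ hf w₁ w₂ k).congr
      (integrandP_eqOn H ht₁ hw₂ f k)).integrableOn Ico_subset_Icc_self
  · exact (admissible_integrandL hf w₁ k).integrableOn
      fun s hs => ⟨hs.1, hs.2.le.trans h₁.2⟩

end Helmholtz

/-! ### Assembly -/

theorem mainTheorem9 (g : Derivator) (T : ℝ) (hT : 0 < T)
    (h0 : (0 : ℝ) ∉ g.jumpSet ∪ g.negSet)
    (hTg : T ∉ g.posSet ∪ g.jumpSet ∪ g.constSet)
    (f : ℝ → ℂ) (hf : g.MemBC T f)
    (t₁ : ℝ) (ht₁ : t₁ ∈ Icc 0 T ∩ g.jumpSet)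
    (w₁ w₂ : ℝ) (hw₁ : w₁ ≠ 0) (hw₂ : w₂ ≠ 0) (x₀ v₀ : ℂ) :
    Helmholtz.FormulasWellDefined g T t₁ w₁ w₂ f ∧
    (∀ k, Helmholtz.IsSolution g T t₁ w₁ w₂ (fun _ => 0) (Helmholtz.y g T t₁ w₁ w₂ k)) ∧
    Helmholtz.IsTheSolutionIVP g T t₁ w₁ w₂ (fun _ => 0) x₀ v₀
      (Helmholtz.vh g T t₁ w₁ w₂ x₀ v₀) ∧
    Helmholtz.IsSolution g T t₁ w₁ w₂ f (Helmholtz.vp g T t₁ w₁ w₂ f) ∧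
    Helmholtz.IsTheSolutionIVP g T t₁ w₁ w₂ f x₀ v₀
      (fun t => Helmholtz.vp g T t₁ w₁ w₂ f t + Helmholtz.vh g T t₁ w₁ w₂ x₀ v₀ t) := by
  have H : g.GoodInterval T := ⟨hT, h0, hTg⟩
  obtain ⟨h₁, hj⟩ := ht₁
  have hS := Helmholtz.memBC_sol hj T w₁ w₂
  have hS' := Helmholtz.memBC_solDeriv hj T w₁ w₂
  have hm : (0 : ℝ) ∈ Icc 0 T := ⟨le_rfl, hT.le⟩
  have hh := Helmholtz.isSolution_of_hasGDeriv H hj (Derivator.memBC_const 0)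
    (Helmholtz.memBC_homSol hj T w₁ w₂ x₀ v₀) (Helmholtz.memBC_homSolDeriv hj T w₁ w₂ x₀ v₀)
    (fun t ht => Helmholtz.hasGDeriv_homSol H hj hw₂ ht x₀ v₀)
    (fun t ht => Helmholtz.hasGDeriv_homSolDeriv H hj hw₂ ht x₀ v₀)
    (Helmholtz.vh_eqOn g T t₁ w₁ w₂ x₀ v₀)
  have hvp := Helmholtz.vp_eqOn (w₁ := w₁) H hj h₁.1 hw₂ hf
  have hF := Helmholtz.memBC_varParam hj hf w₁ w₂ hS
  have hF' := Helmholtz.memBC_varParam hj hf w₁ w₂ hS'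
  have hd := fun t (ht : t ∈ Icc 0 T) =>
    Helmholtz.hasGDeriv_varParam_sol (w₁ := w₁) H hj hf hw₂ ht
  have hd' := fun t (ht : t ∈ Icc 0 T) =>
    Helmholtz.hasGDeriv_varParam_solDeriv H hj hf hw₁ hw₂ h₁.1 ht
  have hp := Helmholtz.isSolution_of_hasGDeriv H hj hf hF hF' hd hd' hvp
  have hs := Helmholtz.isSolution_of_hasGDeriv (w₁ := w₁) (w₂ := w₂) H hj hf
    (hF.add (Helmholtz.memBC_homSol hj T w₁ w₂ x₀ v₀))
    (hF'.add (Helmholtz.memBC_homSolDeriv hj T w₁ w₂ x₀ v₀))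
    (fun t ht => (hd t ht).add (Helmholtz.hasGDeriv_homSol H hj hw₂ ht x₀ v₀))
    (fun t ht => by
      have h := (hd' t ht).add (Helmholtz.hasGDeriv_homSolDeriv (w₁ := w₁) H hj hw₂ ht x₀ v₀)
      refine (congrArg (g.HasGDeriv T _ t) ?_).mp h
      ring)
    (v := fun t => Helmholtz.vp g T t₁ w₁ w₂ f t + Helmholtz.vh g T t₁ w₁ w₂ x₀ v₀ t)
    (fun t ht => by
      simp only [hvp ht, Helmholtz.vh_eqOn g T t₁ w₁ w₂ x₀ v₀ ht])
  -- At `0` the integrals are over the empty set, so `v_p` and its `g`-derivative vanish there and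
  -- `v_h` alone carries the initial data.
  have hz : ∀ Y, Helmholtz.varParam g t₁ w₁ w₂ f Y 0 = 0 := fun Y => by
    simp [Helmholtz.varParam]
  have hx := Helmholtz.homSol_zero (g := g) (w₂ := w₂) hw₁ h₁.1 x₀ v₀
  have hv := Helmholtz.homSolDeriv_zero (g := g) (w₂ := w₂) hw₁ h₁.1 x₀ v₀
  have ih : Helmholtz.IsSolutionIVP g T t₁ w₁ w₂ (fun _ => 0) x₀ v₀
      (Helmholtz.vh g T t₁ w₁ w₂ x₀ v₀) :=
    ⟨hh.1, by rw [← Helmholtz.vh_eqOn g T t₁ w₁ w₂ x₀ v₀ hm, hx], by rw [← hh.2 hm, hv]⟩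
  have is : Helmholtz.IsSolutionIVP g T t₁ w₁ w₂ f x₀ v₀
      (fun t => Helmholtz.vp g T t₁ w₁ w₂ f t + Helmholtz.vh g T t₁ w₁ w₂ x₀ v₀ t) :=
    ⟨hs.1, by simp only [← hvp hm, ← Helmholtz.vh_eqOn g T t₁ w₁ w₂ x₀ v₀ hm, hz, hx, zero_add],
      by rw [← hs.2 hm]; simp only [hz, hv, zero_add]⟩
  exact ⟨Helmholtz.formulasWellDefined H hj h₁ hw₂ hf,
    fun k => (Helmholtz.isSolution_y H hj hw₂ k).1, ⟨ih, fun u hu => hu.eqOn H hj ih⟩, hp.1,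
    ⟨is, fun u hu => hu.eqOn H hj is⟩⟩
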